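/- Let $\mathfrak B$ be a $2$-category (or, more generally, a bicategory), and let $\mathcal T=(\mathcal T,m,\eta,\mu,\iota,\tau)$ be a pseudomonad on $\mathfrak B$: a pseudofunctor $\mathcal T$ with compositors $\mathfrak t_{fg}:\mathcal T(f)\mathcal T(g)\cong\mathcal T(fg)$ and $\mathfrak t_X:\mathrm{id}_{\mathcal TX}\cong\mathcal T(\mathrm{id}_X)$, pseudonatural transformations $m:\mathcal T^2\to\mathcal T$ and $\eta:\mathrm{Id}\to\mathcal T$, and invertible modifications $\mu:m(\mathcal Tm)\cong m(m\mathcal T)$, $\iota:m(\eta\mathcal T)\cong\mathrm{id}$, $\tau:\mathrm{id}\cong m(\mathcal T\eta)$ subject to the usual associativity and identity coherence equations. A lax $\mathcal T$-algebra on an object $Z$ is $\mathtt z=(Z,\mathfrak{alg}_{\mathtt z},\overline{\mathtt z},\overline{\mathtt z}_0)$ with $\mathfrak{alg}_{\mathtt z}:\mathcal TZ\to Z$, $\overline{\mathtt z}:\mathfrak{alg}_{\mathtt z}\mathcal T(\mathfrak{alg}_{\mathtt z})\Rightarrow\mathfrak{alg}_{\mathtt z}m_Z$ and $\overline{\mathtt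 z}_0:\mathrm{id}_Z\Rightarrow\mathfrak{alg}_{\mathtt z}\eta_Z$ satisfying the usual associativity and two unit coherence equations. For lax $\mathcal T$-algebras $\mathtt z$ on $Z$ and $\mathtt y$ on $Y$, a lax $\mathcal T$-morphism structure $\mathtt z\to\mathtt y$ on $g:Z\to Y$ is a $2$-cell $\mathfrak{alg}_{\mathtt y}\mathcal T(g)\Rightarrow g\,\mathfrak{alg}_{\mathtt z}$, and a colax $\mathcal T$-morphism structure $\mathtt y\to\mathtt z$ on $f:Y\to Z$ is a $2$-cell $f\,\mathfrak{alg}_{\mathtt y}\Rightarrow\mathfrak{alg}_{\mathtt z}\mathcal T(f)$, in both cases compatible with the algebra multiplications (through $m$) and units (through $\eta$). Write $\mathsf{Lax}(\mathtt z,\mathtt y)_g$ and $\mathsf{Colax}(\mathtt y,\mathtt z)_f$ for the collections of these structures. For a morphism $g:Z\to Y$, let $\mathsf{Lax}_g$ be the category of lax $\mathcal T$-structures for $g$, i.e. the pullback of the inclusion $\mathsf 2\to\mathfrak B$ of $g$ along the forgetful functor from lax $\mathcal T$-algebras and lax $\mathcal T$-morphisms to $\mathfrak B$. Its objects are the lax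 $\mathcal T$-algebra structures on the source $Z$ and those on the target $Y$ (taken disjointly); its arrows are the lax $\mathcal T$-morphism structures on $\mathrm{id}_Z$, on $g$ and on $\mathrm{id}_Y$, between algebras over the corresponding ends. For $f:Y\to Z$ let $\mathsf{Colax}_f$ be the category of colax $\mathcal T$-structures for $f$, defined in the same way with colax $\mathcal T$-morphisms. Let $(f\dashv g,\epsilon,\rho):Y\to Z$ be an adjunction in $\mathfrak B$, with $f:Y\to Z$, $g:Z\to Y$, $\epsilon:fg\Rightarrow\mathrm{id}_Z$ and $\rho:\mathrm{id}_Y\Rightarrow gf$. (1) For all lax $\mathcal T$-algebras $\mathtt y$ on $Y$ and $\mathtt z$ on $Z$, the mate correspondence under the adjunctions $(\mathcal T(f)\dashv\mathcal T(g),\ \mathfrak t_Z^{-1}\cdot\mathcal T(\epsilon)\cdot\mathfrak t_{fg},\ \mathfrak t_{gf}^{-1}\cdot\mathcal T(\rho)\cdot\mathfrak t_Y)$ and $(f\dashv g,\epsilon,\rho)$ restricts to a bijection $$\diamond:\mathsf{Lax}(\mathtt z,\mathtt y)_g\cong\mathsf{Colax}(\mathtt y,\mathtt z)_f .$$ (2)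 These bijections, together with the corresponding ones for the identity adjunctions on $Y$ and $Z$, form an isomorphism of categories $$\mathsf{Lax}_g\;\cong\;(\mathsf{Colax}_f)^{\mathrm{op}}$$ which is the identity on lax $\mathcal T$-algebra structures (exchanging source and target: the source of $g$ is the target of $f$) and which sends each arrow to its mate, under $f\dashv g$ for the arrows over $g$, and under the identity adjunction for the arrows over $\mathrm{id}_Z$ or $\mathrm{id}_Y$. -/

import Mathlib

open CategoryTheory Bicategory

universe w v u

namespace PseudomonadTheory

section Hat

variable {B : Type*} [Bicategory B] {C : Type*} [Bicategory C]

/-- For a 2-cell `θ` between composites, the 2-cell `T.map₂ θ` conjugated by the compositors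
of the pseudofunctor `T`. -/
def hat (T : B ⥤ᵖ C) {a b c d : B} {p : a ⟶ b} {q : b ⟶ d} {r : a ⟶ c} {s : c ⟶ d}
    (θ : p ≫ q ⟶ r ≫ s) : T.map p ≫ T.map q ⟶ T.map r ≫ T.map s :=
  (T.mapComp p q).inv ≫ T.map₂ θ ≫ (T.mapComp r s).hom

/-- The same for a 2-cell whose source is an identity 1-cell. -/
def hatFromId (T : B ⥤ᵖ C) {a c : B} {r : a ⟶ c} {s : c ⟶ a}
    (θ : 𝟙 a ⟶ r ≫ s) : 𝟙 (T.obj a) ⟶ T.map r ≫ T.map s :=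
  (T.mapId a).inv ≫ T.map₂ θ ≫ (T.mapComp r s).hom

/-- The same for a 2-cell whose target is an identity 1-cell. -/
def hatToId (T : B ⥤ᵖ C) {a b : B} {p : a ⟶ b} {q : b ⟶ a}
    (θ : p ≫ q ⟶ 𝟙 a) : T.map p ≫ T.map q ⟶ 𝟙 (T.obj a) :=
  (T.mapComp p q).inv ≫ T.map₂ θ ≫ (T.mapId a).hom

end Hat

/-- The data of a pseudomonad `(T, m, η, μ, ι, τ)`, before the equations that it has to satisfy:
a pseudofunctor `T`, pseudonatural transformations `m : T² ⟶ T` and `η : 𝟭 ⟶ T`, and the components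
of invertible modifications `μ : m ∘ Tm ≅ m ∘ mT`, `ι : m ∘ ηT ≅ id`, `τ : id ≅ m ∘ Tη`.
(`≫` is composition in diagrammatic order.) -/
structure PseudomonadData (B : Type u) [Bicategory.{w, v} B] extends Pseudofunctor B B where
  /-- The multiplication `T² ⟶ T`. -/
  m : Pseudofunctor.StrongTrans (toPseudofunctor.comp toPseudofunctor) toPseudofunctor
  /-- The unit `𝟭 ⟶ T`. -/
  η : Pseudofunctor.StrongTrans (Pseudofunctor.id B) toPseudofunctor
  /-- The associativity modification `m ∘ Tm ≅ m ∘ mT`. -/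
  μ (Z : B) : (map (m.app Z) ≫ m.app Z : obj (obj (obj Z)) ⟶ obj Z) ≅
    (m.app (obj Z) ≫ m.app Z : obj (obj (obj Z)) ⟶ obj Z)
  /-- The identity modification `m ∘ ηT ≅ id`. -/
  ι (Z : B) : (η.app (obj Z) ≫ m.app Z : obj Z ⟶ obj Z) ≅ 𝟙 (obj Z)
  /-- The identity modification `id ≅ m ∘ Tη`. -/
  τ (Z : B) : 𝟙 (obj Z) ≅ (map (η.app Z) ≫ m.app Z : obj Z ⟶ obj Z)

namespace PseudomonadData

variable {B : Type u} [Bicategory.{w, v} B] (T : PseudomonadData B)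

/-- The component `T²Z ⟶ TZ` of the multiplication. -/
def mApp (Z : B) : T.obj (T.obj Z) ⟶ T.obj Z := T.m.app Z

/-- The pseudonaturality 2-cell of the multiplication. -/
def mNat {Y Z : B} (f : Y ⟶ Z) :
    T.map (T.map f) ≫ T.mApp Z ≅ T.mApp Y ≫ T.map f := T.m.naturality f

/-- The component `Z ⟶ TZ` of the unit. -/
def ηApp (Z : B) : Z ⟶ T.obj Z := T.η.app Z

/-- The pseudonaturality 2-cell of the unit. -/
def ηNat {Y Z : B} (f : Y ⟶ Z) : f ≫ T.ηApp Z ≅ T.ηApp Y ≫ T.map f := T.η.naturality f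

/-- The component at `Z` of `μ : m ∘ Tm ≅ m ∘ mT`. -/
def μApp (Z : B) : T.map (T.mApp Z) ≫ T.mApp Z ≅ T.mApp (T.obj Z) ≫ T.mApp Z := T.μ Z

/-- The component at `Z` of `ι : m ∘ ηT ≅ id`. -/
def ιApp (Z : B) : T.ηApp (T.obj Z) ≫ T.mApp Z ≅ 𝟙 (T.obj Z) := T.ι Z

/-- The component at `Z` of `τ : id ≅ m ∘ Tη`. -/
def τApp (Z : B) : 𝟙 (T.obj Z) ≅ T.map (T.ηApp Z) ≫ T.mApp Z := T.τ Z

end PseudomonadData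

/-- A pseudomonad on a bicategory: the families `μ`, `ι`, `τ` are modifications, and they satisfy
the associativity and the identity coherence equation. -/
structure Pseudomonad (B : Type u) [Bicategory.{w, v} B] extends PseudomonadData B where
  μ_naturality {X Y : B} (f : X ⟶ Y) :
    map (map (map f)) ◁ (toPseudomonadData.μApp Y).hom ≫ (α_ _ _ _).inv ≫
        (toPseudomonadData.mNat (map f)).hom ▷ toPseudomonadData.mApp Y ≫ (α_ _ _ _).hom ≫
          toPseudomonadData.mApp (obj X) ◁ (toPseudomonadData.mNat f).hom ≫ (α_ _ _ _).inv =
      (α_ _ _ _).inv ≫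
        hat toPseudofunctor (toPseudomonadData.mNat f).hom ▷ toPseudomonadData.mApp Y ≫
          (α_ _ _ _).hom ≫ map (toPseudomonadData.mApp X) ◁ (toPseudomonadData.mNat f).hom ≫
            (α_ _ _ _).inv ≫ (toPseudomonadData.μApp X).hom ▷ map f
  ι_naturality {X Y : B} (f : X ⟶ Y) :
    map f ◁ (toPseudomonadData.ιApp Y).hom ≫ (ρ_ (map f)).hom ≫ (λ_ (map f)).inv =
      (α_ _ _ _).inv ≫ (toPseudomonadData.ηNat (map f)).hom ▷ toPseudomonadData.mApp Y ≫
        (α_ _ _ _).hom ≫ toPseudomonadData.ηApp (obj X) ◁ (toPseudomonadData.mNat f).hom ≫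
          (α_ _ _ _).inv ≫ (toPseudomonadData.ιApp X).hom ▷ map f
  τ_naturality {X Y : B} (f : X ⟶ Y) :
    map f ◁ (toPseudomonadData.τApp Y).hom ≫ (α_ _ _ _).inv ≫
        hat toPseudofunctor (toPseudomonadData.ηNat f).hom ▷ toPseudomonadData.mApp Y ≫
          (α_ _ _ _).hom ≫ map (toPseudomonadData.ηApp X) ◁ (toPseudomonadData.mNat f).hom ≫
            (α_ _ _ _).inv =
      (ρ_ (map f)).hom ≫ (λ_ (map f)).inv ≫ (toPseudomonadData.τApp X).hom ▷ map f
  associativity (Z : B) :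
    (α_ _ _ _).inv ≫
        hat toPseudofunctor (toPseudomonadData.μApp Z).hom ▷ toPseudomonadData.mApp Z ≫
          (α_ _ _ _).hom ≫
            map (toPseudomonadData.mApp (obj Z)) ◁ (toPseudomonadData.μApp Z).hom ≫
              (α_ _ _ _).inv ≫
                (toPseudomonadData.μApp (obj Z)).hom ▷ toPseudomonadData.mApp Z ≫
                  (α_ _ _ _).hom =
      map (map (toPseudomonadData.mApp Z)) ◁ (toPseudomonadData.μApp Z).hom ≫ (α_ _ _ _).inv ≫
        (toPseudomonadData.mNat (toPseudomonadData.mApp Z)).hom ▷ toPseudomonadData.mApp Z ≫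
          (α_ _ _ _).hom ≫
            toPseudomonadData.mApp (obj (obj Z)) ◁ (toPseudomonadData.μApp Z).hom
  identity (Z : B) :
    map (toPseudomonadData.ηApp (obj Z)) ◁ (toPseudomonadData.μApp Z).hom ≫ (α_ _ _ _).inv ≫
        (toPseudomonadData.τApp (obj Z)).inv ▷ toPseudomonadData.mApp Z =
      (α_ _ _ _).inv ≫
        hatToId toPseudofunctor (toPseudomonadData.ιApp Z).hom ▷ toPseudomonadData.mApp Z

variable {B : Type u} [Bicategory.{w, v} B]

/-- A lax algebra structure on the object `Z`, for a pseudomonad `T`. A lax `T`-algebra is an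
object `Z` together with such a structure. -/
structure LaxAlg (T : Pseudomonad B) (Z : B) where
  /-- The structure 1-cell. -/
  alg : T.obj Z ⟶ Z
  /-- The 2-cell `alg ∘ T(alg) ⟶ alg ∘ m`. -/
  mul : T.map alg ≫ alg ⟶ T.mApp Z ≫ alg
  /-- The 2-cell `id ⟶ alg ∘ η`. -/
  unit : 𝟙 Z ⟶ T.ηApp Z ≫ alg
  assoc :
    (α_ _ _ _).inv ≫ hat T.toPseudofunctor mul ▷ alg ≫ (α_ _ _ _).hom ≫
        T.map (T.mApp Z) ◁ mul ≫ (α_ _ _ _).inv ≫ (T.μApp Z).hom ▷ alg ≫ (α_ _ _ _).hom =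
      T.map (T.map alg) ◁ mul ≫ (α_ _ _ _).inv ≫ (T.mNat alg).hom ▷ alg ≫ (α_ _ _ _).hom ≫
        T.mApp (T.obj Z) ◁ mul
  mul_map_unit :
    (λ_ alg).inv ≫ hatFromId T.toPseudofunctor unit ▷ alg ≫ (α_ _ _ _).hom ≫
        T.map (T.ηApp Z) ◁ mul ≫ (α_ _ _ _).inv ≫ (T.τApp Z).inv ▷ alg ≫ (λ_ alg).hom = 𝟙 alg
  mul_unit :
    (ρ_ alg).inv ≫ alg ◁ unit ≫ (α_ _ _ _).inv ≫ (T.ηNat alg).hom ▷ alg ≫ (α_ _ _ _).hom ≫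
        T.ηApp (T.obj Z) ◁ mul ≫ (α_ _ _ _).inv ≫ (T.ιApp Z).hom ▷ alg ≫ (λ_ alg).hom = 𝟙 alg

/-- A lax morphism structure, from the lax algebra `z` to the lax algebra `y`, on the
1-cell `g : Z ⟶ Y`. A lax morphism `z ⟶ y` is a 1-cell together with such a structure. -/
@[ext]
structure LaxStr {T : Pseudomonad B} {Z Y : B} (z : LaxAlg T Z) (y : LaxAlg T Y)
    (g : Z ⟶ Y) where
  /-- The 2-cell `alg_y ∘ T(g) ⟶ g ∘ alg_z`. -/
  cell : T.map g ≫ y.alg ⟶ z.alg ≫ g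
  cell_mul :
    (α_ _ _ _).inv ≫ hat T.toPseudofunctor cell ▷ y.alg ≫ (α_ _ _ _).hom ≫
        T.map z.alg ◁ cell ≫ (α_ _ _ _).inv ≫ z.mul ▷ g ≫ (α_ _ _ _).hom =
      T.map (T.map g) ◁ y.mul ≫ (α_ _ _ _).inv ≫ (T.mNat g).hom ▷ y.alg ≫ (α_ _ _ _).hom ≫
        T.mApp Z ◁ cell
  cell_unit :
    (ρ_ g).inv ≫ g ◁ y.unit ≫ (α_ _ _ _).inv ≫ (T.ηNat g).hom ▷ y.alg ≫ (α_ _ _ _).hom ≫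
        T.ηApp Z ◁ cell =
      (λ_ g).inv ≫ z.unit ▷ g ≫ (α_ _ _ _).hom

/-- A colax morphism structure, from the lax algebra `y` to the lax algebra `z`, on the
1-cell `f : Y ⟶ Z`. A colax morphism `y ⟶ z` is a 1-cell together with such a structure. -/
@[ext]
structure ColaxStr {T : Pseudomonad B} {Y Z : B} (y : LaxAlg T Y) (z : LaxAlg T Z)
    (f : Y ⟶ Z) where
  /-- The 2-cell `f ∘ alg_y ⟶ alg_z ∘ T(f)`. -/
  cell : y.alg ≫ f ⟶ T.map f ≫ z.alg
  cell_mul :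
    T.map y.alg ◁ cell ≫ (α_ _ _ _).inv ≫ hat T.toPseudofunctor cell ▷ z.alg ≫
        (α_ _ _ _).hom ≫ T.map (T.map f) ◁ z.mul =
      (α_ _ _ _).inv ≫ y.mul ▷ f ≫ (α_ _ _ _).hom ≫ T.mApp Y ◁ cell ≫ (α_ _ _ _).inv ≫
        (T.mNat f).inv ▷ z.alg ≫ (α_ _ _ _).hom
  cell_unit :
    (λ_ f).inv ≫ y.unit ▷ f ≫ (α_ _ _ _).hom ≫ T.ηApp Y ◁ cell ≫ (α_ _ _ _).inv ≫
        (T.ηNat f).inv ▷ z.alg ≫ (α_ _ _ _).hom =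
      (ρ_ f).inv ≫ f ◁ z.unit

section Nat

variable (T : Pseudomonad B)

theorem mNat_natural {X Y : B} {f g : X ⟶ Y} (θ : f ⟶ g) :
    T.map₂ (T.map₂ θ) ▷ T.mApp Y ≫ (T.mNat g).hom = (T.mNat f).hom ≫ T.mApp X ◁ T.map₂ θ :=
  T.m.naturality_naturality θ

theorem mNat_id (X : B) :
    (T.mNat (𝟙 X)).hom ≫ T.mApp X ◁ (T.mapId X).hom =
      (T.map₂ (T.mapId X).hom ≫ (T.mapId (T.obj X)).hom) ▷ T.mApp X ≫ (λ_ _).hom ≫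
        (ρ_ _).inv :=
  T.m.naturality_id X

theorem mNat_comp {X Y Z : B} (f : X ⟶ Y) (g : Y ⟶ Z) :
    (T.mNat (f ≫ g)).hom ≫ T.mApp X ◁ (T.mapComp f g).hom =
      (T.map₂ (T.mapComp f g).hom ≫ (T.mapComp (T.map f) (T.map g)).hom) ▷ T.mApp Z ≫
        (α_ _ _ _).hom ≫ T.map (T.map f) ◁ (T.mNat g).hom ≫ (α_ _ _ _).inv ≫
          (T.mNat f).hom ▷ T.map g ≫ (α_ _ _ _).hom :=
  T.m.naturality_comp f g

theorem ηNat_natural {X Y : B} {f g : X ⟶ Y} (θ : f ⟶ g) :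
    θ ▷ T.ηApp Y ≫ (T.ηNat g).hom = (T.ηNat f).hom ≫ T.ηApp X ◁ T.map₂ θ :=
  T.η.naturality_naturality θ

theorem ηNat_id (X : B) :
    (T.ηNat (𝟙 X)).hom ≫ T.ηApp X ◁ (T.mapId X).hom = (λ_ _).hom ≫ (ρ_ _).inv := by
  have key : (T.ηNat (𝟙 X)).hom ≫ T.ηApp X ◁ (T.mapId X).hom =
      𝟙 (𝟙 X) ▷ T.ηApp X ≫ (λ_ _).hom ≫ (ρ_ _).inv := T.η.naturality_id X
  rwa [id_whiskerRight, Category.id_comp] at key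

theorem ηNat_comp {X Y Z : B} (f : X ⟶ Y) (g : Y ⟶ Z) :
    (T.ηNat (f ≫ g)).hom ≫ T.ηApp X ◁ (T.mapComp f g).hom =
      (α_ _ _ _).hom ≫ f ◁ (T.ηNat g).hom ≫ (α_ _ _ _).inv ≫
        (T.ηNat f).hom ▷ T.map g ≫ (α_ _ _ _).hom := by
  have key : (T.ηNat (f ≫ g)).hom ≫ T.ηApp X ◁ (T.mapComp f g).hom =
      𝟙 (f ≫ g) ▷ T.ηApp Z ≫ (α_ _ _ _).hom ≫ f ◁ (T.ηNat g).hom ≫ (α_ _ _ _).inv ≫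
        (T.ηNat f).hom ▷ T.map g ≫ (α_ _ _ _).hom := T.η.naturality_comp f g
  rwa [id_whiskerRight, Category.id_comp] at key

end Nat

namespace LaxStr

variable {T : Pseudomonad B} {X Y Z : B}

/-- Transport of a lax structure along an isomorphism of 1-cells. -/
def ofIso {z : LaxAlg T Z} {y : LaxAlg T Y} {g g' : Z ⟶ Y} (φ : LaxStr z y g) (e : g ≅ g') :
    LaxStr z y g' where
  cell := T.map₂ e.inv ▷ y.alg ≫ φ.cell ≫ z.alg ◁ e.hom
  cell_mul := by
    have h1 : hat T.toPseudofunctor (T.map₂ e.inv ▷ y.alg ≫ φ.cell ≫ z.alg ◁ e.hom) =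
        T.map₂ (T.map₂ e.inv) ▷ T.map y.alg ≫ hat T.toPseudofunctor φ.cell ≫
          T.map z.alg ◁ T.map₂ e.hom := by
      simp [hat]
    have h2 := mNat_natural T e.inv
    have h3 : T.map₂ e.hom ≫ T.map₂ e.inv = 𝟙 _ := by simp [← T.map₂_comp]
    have h4 := φ.cell_mul
    rw [h1]
    calc
      _ = 𝟙 _ ⊗≫ T.map₂ (T.map₂ e.inv) ▷ (T.map y.alg ≫ y.alg) ⊗≫
          hat T.toPseudofunctor φ.cell ▷ y.alg ⊗≫
            T.map z.alg ◁ (T.map₂ e.hom ≫ T.map₂ e.inv) ▷ y.alg ⊗≫ T.map z.alg ◁ φ.cell ⊗≫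
              ((T.map z.alg ≫ z.alg) ◁ e.hom ≫ z.mul ▷ g') ⊗≫ 𝟙 _ := by bicategory
      _ = 𝟙 _ ⊗≫ T.map₂ (T.map₂ e.inv) ▷ (T.map y.alg ≫ y.alg) ⊗≫
          ((α_ _ _ _).inv ≫ hat T.toPseudofunctor φ.cell ▷ y.alg ≫ (α_ _ _ _).hom ≫
            T.map z.alg ◁ φ.cell ≫ (α_ _ _ _).inv ≫ z.mul ▷ g ≫ (α_ _ _ _).hom) ⊗≫
              (T.mApp Z ≫ z.alg) ◁ e.hom ⊗≫ 𝟙 _ := by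
        rw [h3, whisker_exchange]; bicategory
      _ = 𝟙 _ ⊗≫ (T.map₂ (T.map₂ e.inv) ▷ (T.map y.alg ≫ y.alg) ≫ _ ◁ y.mul) ⊗≫
          (T.mNat g).hom ▷ y.alg ⊗≫ T.mApp Z ◁ φ.cell ⊗≫
              (T.mApp Z ≫ z.alg) ◁ e.hom ⊗≫ 𝟙 _ := by
        rw [h4]; bicategory
      _ = 𝟙 _ ⊗≫ T.map (T.map g') ◁ y.mul ⊗≫ (T.map₂ (T.map₂ e.inv) ▷ T.mApp Y ≫
          (T.mNat g).hom) ▷ y.alg ⊗≫ T.mApp Z ◁ φ.cell ⊗≫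
              (T.mApp Z ≫ z.alg) ◁ e.hom ⊗≫ 𝟙 _ := by
        rw [← whisker_exchange]; bicategory
      _ = _ := by
        rw [h2]; bicategory
  cell_unit := by
    have h2 := ηNat_natural T e.inv
    have h4 := φ.cell_unit
    have h5 : e.inv ≫ e.hom = 𝟙 _ := by simp
    calc
      _ = 𝟙 _ ⊗≫ g' ◁ y.unit ⊗≫ ((T.ηNat g').hom ≫ T.ηApp Z ◁ T.map₂ e.inv) ▷ y.alg ⊗≫
          T.ηApp Z ◁ φ.cell ⊗≫ T.ηApp Z ◁ z.alg ◁ e.hom ⊗≫ 𝟙 _ := by bicategory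
      _ = 𝟙 _ ⊗≫ (g' ◁ y.unit ≫ e.inv ▷ (T.ηApp Y ≫ y.alg)) ⊗≫ (T.ηNat g).hom ▷ y.alg ⊗≫
          T.ηApp Z ◁ φ.cell ⊗≫ T.ηApp Z ◁ z.alg ◁ e.hom ⊗≫ 𝟙 _ := by
        rw [← h2]; bicategory
      _ = e.inv ⊗≫ ((ρ_ g).inv ≫ g ◁ y.unit ≫ (α_ _ _ _).inv ≫ (T.ηNat g).hom ▷ y.alg ≫
          (α_ _ _ _).hom ≫ T.ηApp Z ◁ φ.cell) ⊗≫ T.ηApp Z ◁ z.alg ◁ e.hom ⊗≫ 𝟙 _ := by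
        rw [whisker_exchange]; bicategory
      _ = 𝟙 _ ⊗≫ e.inv ⊗≫ (z.unit ▷ g ≫ (T.ηApp Z ≫ z.alg) ◁ e.hom) ⊗≫ 𝟙 _ := by
        rw [h4]; bicategory
      _ = 𝟙 _ ⊗≫ (e.inv ≫ e.hom) ⊗≫ z.unit ▷ g' ⊗≫ 𝟙 _ := by
        rw [← whisker_exchange]; bicategory
      _ = _ := by
        rw [h5]; bicategory

/-- The identity lax morphism of a lax algebra. -/
def id (z : LaxAlg T Z) : LaxStr z z (𝟙 Z) where
  cell := (T.mapId Z).hom ▷ z.alg ≫ (λ_ _).hom ≫ (ρ_ _).inv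
  cell_mul := by
    have h1 : hat T.toPseudofunctor ((T.mapId Z).hom ▷ z.alg ≫ (λ_ _).hom ≫ (ρ_ _).inv) =
        (T.map₂ (T.mapId Z).hom ≫ (T.mapId (T.obj Z)).hom) ▷ T.map z.alg ≫ (λ_ _).hom ≫
          (ρ_ _).inv ≫ T.map z.alg ◁ (T.mapId Z).inv := by
      simp [hat, T.map₂_iso_inv]
    have h2 := mNat_id T Z
    rw [h1]
    set u := T.map₂ (T.mapId Z).hom ≫ (T.mapId (T.obj Z)).hom
    have h3 : (T.mapId Z).inv ≫ (T.mapId Z).hom = 𝟙 _ := by simp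
    calc
      _ = 𝟙 _ ⊗≫ u ▷ (T.map z.alg ≫ z.alg) ⊗≫
          T.map z.alg ◁ ((T.mapId Z).inv ≫ (T.mapId Z).hom) ▷ z.alg ⊗≫ z.mul ⊗≫ 𝟙 _ := by
        bicategory
      _ = 𝟙 _ ⊗≫ (u ▷ (T.map z.alg ≫ z.alg) ≫ 𝟙 _ ◁ z.mul) ⊗≫ 𝟙 _ := by
        rw [h3]; bicategory
      _ = 𝟙 _ ⊗≫ T.map (T.map (𝟙 Z)) ◁ z.mul ⊗≫ (u ▷ T.mApp Z ≫ (λ_ _).hom ≫ (ρ_ _).inv)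
            ▷ z.alg ⊗≫ 𝟙 _ := by
        rw [← whisker_exchange]; bicategory
      _ = _ := by
        rw [← h2]; bicategory
  cell_unit := by
    have h2 := ηNat_id T Z
    calc
      _ = 𝟙 _ ⊗≫ 𝟙 Z ◁ z.unit ⊗≫ ((T.ηNat (𝟙 Z)).hom ≫ T.ηApp Z ◁ (T.mapId Z).hom) ▷ z.alg
          ⊗≫ 𝟙 _ := by bicategory
      _ = _ := by rw [h2]; bicategory

/-- The composite of two lax morphisms. -/
def comp {z : LaxAlg T Z} {y : LaxAlg T Y} {x : LaxAlg T X} {g : Z ⟶ Y} {h : Y ⟶ X}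
    (φ : LaxStr z y g) (ψ : LaxStr y x h) : LaxStr z x (g ≫ h) where
  cell := (T.mapComp g h).hom ▷ x.alg ≫ (α_ _ _ _).hom ≫ T.map g ◁ ψ.cell ≫ (α_ _ _ _).inv ≫
    φ.cell ▷ h ≫ (α_ _ _ _).hom
  cell_mul := by
    have h1 : hat T.toPseudofunctor ((T.mapComp g h).hom ▷ x.alg ≫ (α_ _ _ _).hom ≫
        T.map g ◁ ψ.cell ≫ (α_ _ _ _).inv ≫ φ.cell ▷ h ≫ (α_ _ _ _).hom) =
        (T.map₂ (T.mapComp g h).hom ≫ (T.mapComp (T.map g) (T.map h)).hom) ▷ T.map x.alg ≫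
          (α_ _ _ _).hom ≫ T.map (T.map g) ◁ hat T.toPseudofunctor ψ.cell ≫ (α_ _ _ _).inv ≫
            hat T.toPseudofunctor φ.cell ▷ T.map h ≫ (α_ _ _ _).hom ≫
              T.map z.alg ◁ (T.mapComp g h).inv := by
      simp [hat, T.map₂_iso_inv]
    have h2 := mNat_comp T g h
    rw [h1]
    set u := T.map₂ (T.mapComp g h).hom ≫ (T.mapComp (T.map g) (T.map h)).hom
    have h3 : (T.mapComp g h).inv ≫ (T.mapComp g h).hom = 𝟙 _ := by simp
    have h4 := φ.cell_mul
    have h5 := ψ.cell_mul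
    calc
      _ = 𝟙 _ ⊗≫ u ▷ (T.map x.alg ≫ x.alg) ⊗≫
          T.map (T.map g) ◁ hat T.toPseudofunctor ψ.cell ▷ x.alg ⊗≫
            hat T.toPseudofunctor φ.cell ▷ T.map h ▷ x.alg ⊗≫
              T.map z.alg ◁ ((T.mapComp g h).inv ≫ (T.mapComp g h).hom) ▷ x.alg ⊗≫
                T.map z.alg ◁ T.map g ◁ ψ.cell ⊗≫
                  T.map z.alg ◁ φ.cell ▷ h ⊗≫ z.mul ▷ (g ≫ h) ⊗≫ 𝟙 _ := by
        bicategory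
      _ = 𝟙 _ ⊗≫ u ▷ (T.map x.alg ≫ x.alg) ⊗≫
          T.map (T.map g) ◁ hat T.toPseudofunctor ψ.cell ▷ x.alg ⊗≫
            (hat T.toPseudofunctor φ.cell ▷ (T.map h ≫ x.alg) ≫
                (T.map z.alg ≫ T.map g) ◁ ψ.cell) ⊗≫
                  T.map z.alg ◁ φ.cell ▷ h ⊗≫ z.mul ▷ (g ≫ h) ⊗≫ 𝟙 _ := by
        rw [h3]; bicategory
      _ = 𝟙 _ ⊗≫ u ▷ (T.map x.alg ≫ x.alg) ⊗≫
          T.map (T.map g) ◁ hat T.toPseudofunctor ψ.cell ▷ x.alg ⊗≫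
            T.map (T.map g) ◁ T.map y.alg ◁ ψ.cell ⊗≫ ((α_ _ _ _).inv ≫
              hat T.toPseudofunctor φ.cell ▷ y.alg ≫ (α_ _ _ _).hom ≫
                T.map z.alg ◁ φ.cell ≫ (α_ _ _ _).inv ≫ z.mul ▷ g ≫ (α_ _ _ _).hom) ▷ h
                  ⊗≫ 𝟙 _ := by
        rw [← whisker_exchange]; bicategory
      _ = 𝟙 _ ⊗≫ u ▷ (T.map x.alg ≫ x.alg) ⊗≫
          T.map (T.map g) ◁ ((α_ _ _ _).inv ≫ hat T.toPseudofunctor ψ.cell ▷ x.alg ≫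
            (α_ _ _ _).hom ≫ T.map y.alg ◁ ψ.cell ≫ (α_ _ _ _).inv ≫ y.mul ▷ h ≫
              (α_ _ _ _).hom) ⊗≫ (T.mNat g).hom ▷ y.alg ▷ h ⊗≫ T.mApp Z ◁ φ.cell ▷ h
                  ⊗≫ 𝟙 _ := by
        rw [h4]; bicategory
      _ = 𝟙 _ ⊗≫ (u ▷ (T.map x.alg ≫ x.alg) ≫ _ ◁ x.mul) ⊗≫
          T.map (T.map g) ◁ (T.mNat h).hom ▷ x.alg ⊗≫
            ((T.map (T.map g) ≫ T.mApp Y) ◁ ψ.cell ≫ (T.mNat g).hom ▷ (y.alg ≫ h)) ⊗≫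
              T.mApp Z ◁ φ.cell ▷ h ⊗≫ 𝟙 _ := by
        rw [h5]; bicategory
      _ = 𝟙 _ ⊗≫ T.map (T.map (g ≫ h)) ◁ x.mul ⊗≫ (u ▷ T.mApp X ≫
        (α_ _ _ _).hom ≫ T.map (T.map g) ◁ (T.mNat h).hom ≫ (α_ _ _ _).inv ≫
          (T.mNat g).hom ▷ T.map h ≫ (α_ _ _ _).hom) ▷ x.alg ⊗≫
            T.mApp Z ◁ T.map g ◁ ψ.cell ⊗≫ T.mApp Z ◁ φ.cell ▷ h ⊗≫ 𝟙 _ := by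
        rw [whisker_exchange, ← whisker_exchange]; bicategory
      _ = _ := by
        rw [← h2]; bicategory
  cell_unit := by
    have h2 := ηNat_comp T g h
    have h4 := φ.cell_unit
    have h5 := ψ.cell_unit
    calc
      _ = 𝟙 _ ⊗≫ (g ≫ h) ◁ x.unit ⊗≫ ((T.ηNat (g ≫ h)).hom ≫ T.ηApp Z ◁ (T.mapComp g h).hom)
          ▷ x.alg ⊗≫ T.ηApp Z ◁ T.map g ◁ ψ.cell ⊗≫ T.ηApp Z ◁ φ.cell ▷ h ⊗≫ 𝟙 _ := by
        bicategory
      _ = 𝟙 _ ⊗≫ g ◁ h ◁ x.unit ⊗≫ g ◁ (T.ηNat h).hom ▷ x.alg ⊗≫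
          ((T.ηNat g).hom ▷ (T.map h ≫ x.alg) ≫ (T.ηApp Z ≫ T.map g) ◁ ψ.cell) ⊗≫
            T.ηApp Z ◁ φ.cell ▷ h ⊗≫ 𝟙 _ := by
        rw [h2]; bicategory
      _ = 𝟙 _ ⊗≫ g ◁ ((ρ_ h).inv ≫ h ◁ x.unit ≫ (α_ _ _ _).inv ≫ (T.ηNat h).hom ▷ x.alg ≫
          (α_ _ _ _).hom ≫ T.ηApp Y ◁ ψ.cell) ⊗≫ (T.ηNat g).hom ▷ y.alg ▷ h ⊗≫
            T.ηApp Z ◁ φ.cell ▷ h ⊗≫ 𝟙 _ := by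
        rw [← whisker_exchange]; bicategory
      _ = 𝟙 _ ⊗≫ ((ρ_ g).inv ≫ g ◁ y.unit ≫ (α_ _ _ _).inv ≫ (T.ηNat g).hom ▷ y.alg ≫
          (α_ _ _ _).hom ≫ T.ηApp Z ◁ φ.cell) ▷ h ⊗≫ 𝟙 _ := by
        rw [h5]; bicategory
      _ = _ := by
        rw [h4]; bicategory

end LaxStr

section NatInv

variable (T : Pseudomonad B)

theorem mNat_inv_natural {X Y : B} {f g : X ⟶ Y} (θ : f ⟶ g) :
    T.mApp X ◁ T.map₂ θ ≫ (T.mNat g).inv = (T.mNat f).inv ≫ T.map₂ (T.map₂ θ) ▷ T.mApp Y := by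
  rw [Iso.comp_inv_eq, Category.assoc, mNat_natural, Iso.inv_hom_id_assoc]

theorem mNat_inv_id (X : B) :
    T.mApp X ◁ (T.mapId X).inv ≫ (T.mNat (𝟙 X)).inv = (ρ_ _).hom ≫ (λ_ _).inv ≫
      ((T.mapId (T.obj X)).inv ≫ T.map₂ (T.mapId X).inv) ▷ T.mApp X := by
  have key : T.mNat (𝟙 X) ≪≫ whiskerLeftIso (T.mApp X) (T.mapId X) =
      whiskerRightIso (T.map₂Iso (T.mapId X) ≪≫ T.mapId (T.obj X)) (T.mApp X) ≪≫ λ_ _ ≪≫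
        (ρ_ _).symm := Iso.ext (mNat_id T X)
  simpa using congrArg Iso.inv key

theorem mNat_inv_comp {X Y Z : B} (f : X ⟶ Y) (g : Y ⟶ Z) :
    T.mApp X ◁ (T.mapComp f g).inv ≫ (T.mNat (f ≫ g)).inv =
      (α_ _ _ _).inv ≫ (T.mNat f).inv ▷ T.map g ≫ (α_ _ _ _).hom ≫
        T.map (T.map f) ◁ (T.mNat g).inv ≫ (α_ _ _ _).inv ≫
          ((T.mapComp (T.map f) (T.map g)).inv ≫ T.map₂ (T.mapComp f g).inv) ▷ T.mApp Z := by
  have key : T.mNat (f ≫ g) ≪≫ whiskerLeftIso (T.mApp X) (T.mapComp f g) =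
      whiskerRightIso (T.map₂Iso (T.mapComp f g) ≪≫ T.mapComp (T.map f) (T.map g)) (T.mApp Z) ≪≫
        α_ _ _ _ ≪≫ whiskerLeftIso (T.map (T.map f)) (T.mNat g) ≪≫ (α_ _ _ _).symm ≪≫
          whiskerRightIso (T.mNat f) (T.map g) ≪≫ α_ _ _ _ := Iso.ext (mNat_comp T f g)
  simpa using congrArg Iso.inv key

theorem ηNat_inv_natural {X Y : B} {f g : X ⟶ Y} (θ : f ⟶ g) :
    T.ηApp X ◁ T.map₂ θ ≫ (T.ηNat g).inv = (T.ηNat f).inv ≫ θ ▷ T.ηApp Y := by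
  rw [Iso.comp_inv_eq, Category.assoc, ηNat_natural, Iso.inv_hom_id_assoc]

theorem ηNat_inv_id (X : B) :
    T.ηApp X ◁ (T.mapId X).inv ≫ (T.ηNat (𝟙 X)).inv = (ρ_ _).hom ≫ (λ_ _).inv := by
  have key : T.ηNat (𝟙 X) ≪≫ whiskerLeftIso (T.ηApp X) (T.mapId X) = λ_ _ ≪≫ (ρ_ _).symm :=
    Iso.ext (ηNat_id T X)
  simpa using congrArg Iso.inv key

theorem ηNat_inv_comp {X Y Z : B} (f : X ⟶ Y) (g : Y ⟶ Z) :
    T.ηApp X ◁ (T.mapComp f g).inv ≫ (T.ηNat (f ≫ g)).inv =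
      (α_ _ _ _).inv ≫ (T.ηNat f).inv ▷ T.map g ≫ (α_ _ _ _).hom ≫ f ◁ (T.ηNat g).inv ≫
        (α_ _ _ _).inv := by
  have key : T.ηNat (f ≫ g) ≪≫ whiskerLeftIso (T.ηApp X) (T.mapComp f g) =
      α_ _ _ _ ≪≫ whiskerLeftIso f (T.ηNat g) ≪≫ (α_ _ _ _).symm ≪≫
        whiskerRightIso (T.ηNat f) (T.map g) ≪≫ α_ _ _ _ := Iso.ext (ηNat_comp T f g)
  simpa using congrArg Iso.inv key

end NatInv

namespace ColaxStr

variable {T : Pseudomonad B} {X Y Z : B}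

/-- Transport of a colax structure along an isomorphism of 1-cells. -/
def ofIso {y : LaxAlg T Y} {z : LaxAlg T Z} {f f' : Y ⟶ Z} (φ : ColaxStr y z f) (e : f ≅ f') :
    ColaxStr y z f' where
  cell := y.alg ◁ e.inv ≫ φ.cell ≫ T.map₂ e.hom ▷ z.alg
  cell_mul := by
    have h1 : hat T.toPseudofunctor (y.alg ◁ e.inv ≫ φ.cell ≫ T.map₂ e.hom ▷ z.alg) =
        T.map y.alg ◁ T.map₂ e.inv ≫ hat T.toPseudofunctor φ.cell ≫
          T.map₂ (T.map₂ e.hom) ▷ T.map z.alg := by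
      simp [hat]
    have h2 := mNat_inv_natural T e.hom
    have h3 : T.map₂ e.hom ≫ T.map₂ e.inv = 𝟙 _ := by simp [← T.map₂_comp]
    have h4 := φ.cell_mul
    rw [h1]
    calc
      _ = 𝟙 _ ⊗≫ (T.map y.alg ≫ y.alg) ◁ e.inv ⊗≫ T.map y.alg ◁ φ.cell ⊗≫
          T.map y.alg ◁ (T.map₂ e.hom ≫ T.map₂ e.inv) ▷ z.alg ⊗≫
            hat T.toPseudofunctor φ.cell ▷ z.alg ⊗≫
              (T.map₂ (T.map₂ e.hom) ▷ (T.map z.alg ≫ z.alg) ≫ _ ◁ z.mul) := by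
        bicategory
      _ = 𝟙 _ ⊗≫ (T.map y.alg ≫ y.alg) ◁ e.inv ⊗≫ (T.map y.alg ◁ φ.cell ≫ (α_ _ _ _).inv ≫
          hat T.toPseudofunctor φ.cell ▷ z.alg ≫ (α_ _ _ _).hom ≫ T.map (T.map f) ◁ z.mul) ⊗≫
            T.map₂ (T.map₂ e.hom) ▷ (T.mApp Z ≫ z.alg) := by
        rw [h3, ← whisker_exchange]; bicategory
      _ = 𝟙 _ ⊗≫ ((T.map y.alg ≫ y.alg) ◁ e.inv ≫ y.mul ▷ f) ⊗≫ T.mApp Y ◁ φ.cell ⊗≫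
          ((T.mNat f).inv ≫ T.map₂ (T.map₂ e.hom) ▷ T.mApp Z) ▷ z.alg ⊗≫ 𝟙 _ := by
        rw [h4]; bicategory
      _ = _ := by
        rw [← h2, whisker_exchange]; bicategory
  cell_unit := by
    have h2 := ηNat_inv_natural T e.hom
    have h4 := φ.cell_unit
    have h5 : e.inv ≫ e.hom = 𝟙 _ := by simp
    calc
      _ = 𝟙 _ ⊗≫ (y.unit ▷ f' ≫ (T.ηApp Y ≫ y.alg) ◁ e.inv) ⊗≫ T.ηApp Y ◁ φ.cell ⊗≫
          (T.ηApp Y ◁ T.map₂ e.hom ≫ (T.ηNat f').inv) ▷ z.alg ⊗≫ 𝟙 _ := by bicategory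
      _ = e.inv ⊗≫ ((λ_ f).inv ≫ y.unit ▷ f ≫ (α_ _ _ _).hom ≫ T.ηApp Y ◁ φ.cell ≫
          (α_ _ _ _).inv ≫ (T.ηNat f).inv ▷ z.alg ≫ (α_ _ _ _).hom) ⊗≫
            e.hom ▷ (T.ηApp Z ≫ z.alg) := by
        rw [h2, ← whisker_exchange]; bicategory
      _ = e.inv ⊗≫ (f ◁ z.unit ≫ e.hom ▷ (T.ηApp Z ≫ z.alg)) := by
        rw [h4]; bicategory
      _ = (e.inv ≫ e.hom) ⊗≫ f' ◁ z.unit := by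
        rw [whisker_exchange]; bicategory
      _ = _ := by
        rw [h5]; bicategory

/-- The identity colax morphism of a lax algebra. -/
def id (y : LaxAlg T Y) : ColaxStr y y (𝟙 Y) where
  cell := (ρ_ _).hom ≫ (λ_ _).inv ≫ (T.mapId Y).inv ▷ y.alg
  cell_mul := by
    have h1 : hat T.toPseudofunctor ((ρ_ _).hom ≫ (λ_ _).inv ≫ (T.mapId Y).inv ▷ y.alg) =
        T.map y.alg ◁ (T.mapId Y).hom ≫ (ρ_ _).hom ≫ (λ_ _).inv ≫
          ((T.mapId (T.obj Y)).inv ≫ T.map₂ (T.mapId Y).inv) ▷ T.map y.alg := by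
      simp [hat, T.map₂_iso_inv]
    have h2 := mNat_inv_id T Y
    rw [h1]
    set u := (T.mapId (T.obj Y)).inv ≫ T.map₂ (T.mapId Y).inv
    have h3 : (T.mapId Y).inv ≫ (T.mapId Y).hom = 𝟙 _ := by simp
    calc
      _ = 𝟙 _ ⊗≫ T.map y.alg ◁ ((T.mapId Y).inv ≫ (T.mapId Y).hom) ▷ y.alg ⊗≫
          (u ▷ (T.map y.alg ≫ y.alg) ≫ _ ◁ y.mul) := by bicategory
      _ = 𝟙 _ ⊗≫ y.mul ⊗≫ ((ρ_ _).hom ≫ (λ_ _).inv ≫ u ▷ T.mApp Y) ▷ y.alg ⊗≫ 𝟙 _ := by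
        rw [h3, ← whisker_exchange]; bicategory
      _ = _ := by
        rw [← h2]; bicategory
  cell_unit := by
    have h2 := ηNat_inv_id T Y
    calc
      _ = 𝟙 _ ⊗≫ y.unit ▷ 𝟙 Y ⊗≫
          (T.ηApp Y ◁ (T.mapId Y).inv ≫ (T.ηNat (𝟙 Y)).inv) ▷ y.alg ⊗≫ 𝟙 _ := by bicategory
      _ = _ := by rw [h2]; bicategory

/-- The composite of two colax morphisms. -/
def comp {y : LaxAlg T Y} {z : LaxAlg T Z} {x : LaxAlg T X} {f : Y ⟶ Z} {h : Z ⟶ X}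
    (φ : ColaxStr y z f) (ψ : ColaxStr z x h) : ColaxStr y x (f ≫ h) where
  cell := (α_ _ _ _).inv ≫ φ.cell ▷ h ≫ (α_ _ _ _).hom ≫ T.map f ◁ ψ.cell ≫ (α_ _ _ _).inv ≫
    (T.mapComp f h).inv ▷ x.alg
  cell_mul := by
    have h1 : hat T.toPseudofunctor ((α_ _ _ _).inv ≫ φ.cell ▷ h ≫ (α_ _ _ _).hom ≫
        T.map f ◁ ψ.cell ≫ (α_ _ _ _).inv ≫ (T.mapComp f h).inv ▷ x.alg) =
        T.map y.alg ◁ (T.mapComp f h).hom ≫ (α_ _ _ _).inv ≫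
          hat T.toPseudofunctor φ.cell ▷ T.map h ≫ (α_ _ _ _).hom ≫
            T.map (T.map f) ◁ hat T.toPseudofunctor ψ.cell ≫ (α_ _ _ _).inv ≫
              ((T.mapComp (T.map f) (T.map h)).inv ≫ T.map₂ (T.mapComp f h).inv) ▷
                T.map x.alg := by
      simp [hat, T.map₂_iso_inv]
    have h2 := mNat_inv_comp T f h
    rw [h1]
    set u := (T.mapComp (T.map f) (T.map h)).inv ≫ T.map₂ (T.mapComp f h).inv
    have h3 : (T.mapComp f h).inv ≫ (T.mapComp f h).hom = 𝟙 _ := by simp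
    have h4 := φ.cell_mul
    have h5 := ψ.cell_mul
    calc
      _ = 𝟙 _ ⊗≫ T.map y.alg ◁ φ.cell ▷ h ⊗≫ T.map y.alg ◁ T.map f ◁ ψ.cell ⊗≫
          T.map y.alg ◁ ((T.mapComp f h).inv ≫ (T.mapComp f h).hom) ▷ x.alg ⊗≫
            hat T.toPseudofunctor φ.cell ▷ T.map h ▷ x.alg ⊗≫
              T.map (T.map f) ◁ hat T.toPseudofunctor ψ.cell ▷ x.alg ⊗≫
                (u ▷ (T.map x.alg ≫ x.alg) ≫ _ ◁ x.mul) := by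
        bicategory
      _ = 𝟙 _ ⊗≫ T.map y.alg ◁ φ.cell ▷ h ⊗≫
          ((T.map y.alg ≫ T.map f) ◁ ψ.cell ≫
            hat T.toPseudofunctor φ.cell ▷ (T.map h ≫ x.alg)) ⊗≫
              T.map (T.map f) ◁ hat T.toPseudofunctor ψ.cell ▷ x.alg ⊗≫
                T.map (T.map f) ◁ T.map (T.map h) ◁ x.mul ⊗≫ u ▷ (T.mApp X ≫ x.alg) := by
        rw [h3, ← whisker_exchange]; bicategory
      _ = 𝟙 _ ⊗≫ T.map y.alg ◁ φ.cell ▷ h ⊗≫ hat T.toPseudofunctor φ.cell ▷ z.alg ▷ h ⊗≫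
          T.map (T.map f) ◁ (T.map z.alg ◁ ψ.cell ≫ (α_ _ _ _).inv ≫
            hat T.toPseudofunctor ψ.cell ▷ x.alg ≫ (α_ _ _ _).hom ≫
              T.map (T.map h) ◁ x.mul) ⊗≫ u ▷ (T.mApp X ≫ x.alg) := by
        rw [whisker_exchange]; bicategory
      _ = 𝟙 _ ⊗≫ (T.map y.alg ◁ φ.cell ≫ (α_ _ _ _).inv ≫ hat T.toPseudofunctor φ.cell ▷ z.alg ≫
          (α_ _ _ _).hom ≫ T.map (T.map f) ◁ z.mul) ▷ h ⊗≫ T.map (T.map f) ◁ T.mApp Z ◁ ψ.cell ⊗≫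
            T.map (T.map f) ◁ (T.mNat h).inv ▷ x.alg ⊗≫ u ▷ (T.mApp X ≫ x.alg) := by
        rw [h5]; bicategory
      _ = 𝟙 _ ⊗≫ y.mul ▷ (f ≫ h) ⊗≫ T.mApp Y ◁ φ.cell ▷ h ⊗≫
          ((T.mNat f).inv ▷ (z.alg ≫ h) ≫ (T.map (T.map f) ≫ T.mApp Z) ◁ ψ.cell) ⊗≫
            T.map (T.map f) ◁ (T.mNat h).inv ▷ x.alg ⊗≫ u ▷ (T.mApp X ≫ x.alg) := by
        rw [h4]; bicategory
      _ = 𝟙 _ ⊗≫ y.mul ▷ (f ≫ h) ⊗≫ T.mApp Y ◁ φ.cell ▷ h ⊗≫ T.mApp Y ◁ T.map f ◁ ψ.cell ⊗≫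
          ((α_ _ _ _).inv ≫ (T.mNat f).inv ▷ T.map h ≫ (α_ _ _ _).hom ≫
            T.map (T.map f) ◁ (T.mNat h).inv ≫ (α_ _ _ _).inv ≫ u ▷ T.mApp X) ▷ x.alg
              ⊗≫ 𝟙 _ := by
        rw [← whisker_exchange]; bicategory
      _ = _ := by
        rw [← h2]; bicategory
  cell_unit := by
    have h2 := ηNat_inv_comp T f h
    have h4 := φ.cell_unit
    have h5 := ψ.cell_unit
    calc
      _ = 𝟙 _ ⊗≫ y.unit ▷ f ▷ h ⊗≫ T.ηApp Y ◁ φ.cell ▷ h ⊗≫ T.ηApp Y ◁ T.map f ◁ ψ.cell ⊗≫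
          (T.ηApp Y ◁ (T.mapComp f h).inv ≫ (T.ηNat (f ≫ h)).inv) ▷ x.alg ⊗≫ 𝟙 _ := by
        bicategory
      _ = 𝟙 _ ⊗≫ y.unit ▷ f ▷ h ⊗≫ T.ηApp Y ◁ φ.cell ▷ h ⊗≫
          ((T.ηApp Y ≫ T.map f) ◁ ψ.cell ≫ (T.ηNat f).inv ▷ (T.map h ≫ x.alg)) ⊗≫
            f ◁ (T.ηNat h).inv ▷ x.alg ⊗≫ 𝟙 _ := by
        rw [h2]; bicategory
      _ = 𝟙 _ ⊗≫ ((λ_ f).inv ≫ y.unit ▷ f ≫ (α_ _ _ _).hom ≫ T.ηApp Y ◁ φ.cell ≫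
          (α_ _ _ _).inv ≫ (T.ηNat f).inv ▷ z.alg ≫ (α_ _ _ _).hom) ▷ h ⊗≫
            f ◁ T.ηApp Z ◁ ψ.cell ⊗≫ f ◁ (T.ηNat h).inv ▷ x.alg ⊗≫ 𝟙 _ := by
        rw [whisker_exchange]; bicategory
      _ = 𝟙 _ ⊗≫ f ◁ ((λ_ h).inv ≫ z.unit ▷ h ≫ (α_ _ _ _).hom ≫ T.ηApp Z ◁ ψ.cell ≫
          (α_ _ _ _).inv ≫ (T.ηNat h).inv ▷ x.alg ≫ (α_ _ _ _).hom) ⊗≫ 𝟙 _ := by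
        rw [h4]; bicategory
      _ = _ := by
        rw [h5]; bicategory

end ColaxStr

section Coherence

variable {C : Type*} [Bicategory C] (T : B ⥤ᵖ C)

theorem map₂_leftUnitor_inv_comp {a b : B} (g : a ⟶ b) :
    T.map₂ (λ_ g).inv ≫ (T.mapComp (𝟙 a) g).hom ≫ (T.mapId a).hom ▷ T.map g =
      (λ_ (T.map g)).inv := by
  rw [← cancel_mono (λ_ (T.map g)).hom, Category.assoc, Category.assoc,
    ← Pseudofunctor.map₂_left_unitor, ← T.map₂_comp]
  simp only [Iso.inv_hom_id, PrelaxFunctor.map₂_id]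

theorem map₂_rightUnitor_inv_comp {a b : B} (g : a ⟶ b) :
    T.map₂ (ρ_ g).inv ≫ (T.mapComp g (𝟙 b)).hom ≫ T.map g ◁ (T.mapId b).hom =
      (ρ_ (T.map g)).inv := by
  rw [← cancel_mono (ρ_ (T.map g)).hom, Category.assoc, Category.assoc,
    ← Pseudofunctor.map₂_right_unitor, ← T.map₂_comp]
  simp only [Iso.inv_hom_id, PrelaxFunctor.map₂_id]

theorem comp_map₂_leftUnitor {a b : B} (f : a ⟶ b) :
    (T.mapId a).inv ▷ T.map f ≫ (T.mapComp (𝟙 a) f).inv ≫ T.map₂ (λ_ f).hom =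
      (λ_ (T.map f)).hom := by
  rw [Pseudofunctor.map₂_left_unitor, Iso.inv_hom_id_assoc, inv_hom_whiskerRight_assoc]

theorem comp_map₂_rightUnitor {a b : B} (f : a ⟶ b) :
    T.map f ◁ (T.mapId b).inv ≫ (T.mapComp f (𝟙 b)).inv ≫ T.map₂ (ρ_ f).hom =
      (ρ_ (T.map f)).hom := by
  rw [Pseudofunctor.map₂_right_unitor, Iso.inv_hom_id_assoc, whiskerLeft_inv_hom_assoc]

variable {Z Y X W : B} {g : Z ⟶ Y} {h : Y ⟶ X} {l : X ⟶ W} {k : Z ⟶ X} {p : Y ⟶ W} {n : Z ⟶ W}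
  (e : g ≫ h ≅ k) (e' : k ≫ l ≅ n) (d : h ≫ l ≅ p) (d' : g ≫ p ≅ n)

theorem comp_map₂_assoc
    (w : e.hom ▷ l ≫ e'.hom = (α_ _ _ _).hom ≫ g ◁ d.hom ≫ d'.hom) :
    (α_ _ _ _).inv ≫ (T.mapComp g h).inv ▷ T.map l ≫ T.map₂ e.hom ▷ T.map l ≫
        (T.mapComp k l).inv ≫ T.map₂ e'.hom =
      T.map g ◁ (T.mapComp h l).inv ≫ T.map g ◁ T.map₂ d.hom ≫ (T.mapComp g p).inv ≫
        T.map₂ d'.hom := by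
  have h1 : T.map₂ e.hom ▷ T.map l ≫ (T.mapComp k l).inv =
      (T.mapComp (g ≫ h) l).inv ≫ T.map₂ (e.hom ▷ l) := by simp
  have h2 : T.map g ◁ T.map₂ d.hom ≫ (T.mapComp g p).inv =
      (T.mapComp g (h ≫ l)).inv ≫ T.map₂ (g ◁ d.hom) := by simp
  rw [reassoc_of% h1, reassoc_of% h2, ← T.map₂_comp, ← T.map₂_comp, w, T.map₂_comp,
    Pseudofunctor.map₂_associator]
  simp

theorem map₂_assoc_comp
    (w : e.hom ▷ l ≫ e'.hom = (α_ _ _ _).hom ≫ g ◁ d.hom ≫ d'.hom) :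
    T.map₂ e'.inv ≫ (T.mapComp k l).hom ≫ T.map₂ e.inv ▷ T.map l ≫
        (T.mapComp g h).hom ▷ T.map l ≫ (α_ _ _ _).hom =
      T.map₂ d'.inv ≫ (T.mapComp g p).hom ≫ T.map g ◁ T.map₂ d.inv ≫
        T.map g ◁ (T.mapComp h l).hom := by
  have key : (α_ _ _ _).symm ≪≫ whiskerRightIso (T.mapComp g h).symm (T.map l) ≪≫
      whiskerRightIso (T.map₂Iso e) (T.map l) ≪≫ (T.mapComp k l).symm ≪≫ T.map₂Iso e' =
      whiskerLeftIso (T.map g) (T.mapComp h l).symm ≪≫ whiskerLeftIso (T.map g) (T.map₂Iso d) ≪≫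
        (T.mapComp g p).symm ≪≫ T.map₂Iso d' := Iso.ext (comp_map₂_assoc T e e' d d' w)
  simpa using congrArg Iso.inv key

end Coherence

namespace LaxStr

variable {T : Pseudomonad B} {W X Y Z : B}

theorem id_comp_ofIso {z : LaxAlg T Z} {y : LaxAlg T Y} {g : Z ⟶ Y} (φ : LaxStr z y g) :
    ((id z).comp φ).ofIso (λ_ g) = φ := by
  ext
  simp only [ofIso, comp, id]
  have h := map₂_leftUnitor_inv_comp T.toPseudofunctor g
  calc
    _ = 𝟙 _ ⊗≫ (T.map₂ (λ_ g).inv ≫ (T.mapComp (𝟙 Z) g).hom) ▷ y.alg ⊗≫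
        (T.map (𝟙 Z) ◁ φ.cell ≫ (T.mapId Z).hom ▷ (z.alg ≫ g)) ⊗≫ 𝟙 _ := by bicategory
    _ = 𝟙 _ ⊗≫ (T.map₂ (λ_ g).inv ≫ (T.mapComp (𝟙 Z) g).hom ≫ (T.mapId Z).hom ▷ T.map g) ▷ y.alg
        ⊗≫ φ.cell ⊗≫ 𝟙 _ := by rw [whisker_exchange]; bicategory
    _ = _ := by rw [h]; bicategory

theorem comp_id_ofIso {z : LaxAlg T Z} {y : LaxAlg T Y} {g : Z ⟶ Y} (φ : LaxStr z y g) :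
    (φ.comp (id y)).ofIso (ρ_ g) = φ := by
  ext
  simp only [ofIso, comp, id]
  have h := map₂_rightUnitor_inv_comp T.toPseudofunctor g
  calc
    _ = 𝟙 _ ⊗≫ (T.map₂ (ρ_ g).inv ≫ (T.mapComp g (𝟙 Y)).hom ≫ T.map g ◁ (T.mapId Y).hom) ▷ y.alg
        ⊗≫ φ.cell ⊗≫ 𝟙 _ := by bicategory
    _ = _ := by rw [h]; bicategory

theorem comp_assoc_ofIso {z : LaxAlg T Z} {y : LaxAlg T Y} {x : LaxAlg T X} {t : LaxAlg T W}
    {g : Z ⟶ Y} {h : Y ⟶ X} {l : X ⟶ W} (φ : LaxStr z y g) (ψ : LaxStr y x h)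
    (χ : LaxStr x t l) {k : Z ⟶ X} {p : Y ⟶ W} {n : Z ⟶ W} (e : g ≫ h ≅ k) (e' : k ≫ l ≅ n)
    (d : h ≫ l ≅ p) (d' : g ≫ p ≅ n)
    (w : e.hom ▷ l ≫ e'.hom = (α_ _ _ _).hom ≫ g ◁ d.hom ≫ d'.hom) :
    (((φ.comp ψ).ofIso e).comp χ).ofIso e' = (φ.comp ((ψ.comp χ).ofIso d)).ofIso d' := by
  ext
  simp only [ofIso, comp]
  have h1 := map₂_assoc_comp T.toPseudofunctor e e' d d' w
  calc
    _ = 𝟙 _ ⊗≫ (T.map₂ e'.inv ≫ (T.mapComp k l).hom) ▷ t.alg ⊗≫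
        (T.map k ◁ χ.cell ≫ (T.map₂ e.inv ≫ (T.mapComp g h).hom) ▷ (x.alg ≫ l)) ⊗≫
          T.map g ◁ ψ.cell ▷ l ⊗≫ φ.cell ▷ (h ≫ l) ⊗≫ z.alg ◁ (e.hom ▷ l ≫ e'.hom) := by
      bicategory
    _ = 𝟙 _ ⊗≫ (T.map₂ e'.inv ≫ (T.mapComp k l).hom ≫ T.map₂ e.inv ▷ T.map l ≫
        (T.mapComp g h).hom ▷ T.map l ≫ (α_ _ _ _).hom) ▷ t.alg ⊗≫ T.map g ◁ T.map h ◁ χ.cell ⊗≫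
          T.map g ◁ ψ.cell ▷ l ⊗≫ (φ.cell ▷ (h ≫ l) ≫ (z.alg ≫ g) ◁ d.hom) ⊗≫ z.alg ◁ d'.hom := by
      rw [whisker_exchange, w]; bicategory
    _ = _ := by
      rw [h1, ← whisker_exchange]; bicategory

end LaxStr

namespace ColaxStr

variable {T : Pseudomonad B} {W X Y Z : B}

theorem id_comp_ofIso {y : LaxAlg T Y} {z : LaxAlg T Z} {f : Y ⟶ Z} (φ : ColaxStr y z f) :
    ((id y).comp φ).ofIso (λ_ f) = φ := by
  ext
  simp only [ofIso, comp, id]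
  have h := comp_map₂_leftUnitor T.toPseudofunctor f
  calc
    _ = 𝟙 _ ⊗≫ ((T.mapId Y).inv ▷ (y.alg ≫ f) ≫ T.map (𝟙 Y) ◁ φ.cell) ⊗≫
        ((T.mapComp (𝟙 Y) f).inv ≫ T.map₂ (λ_ f).hom) ▷ z.alg ⊗≫ 𝟙 _ := by bicategory
    _ = 𝟙 _ ⊗≫ φ.cell ⊗≫ ((T.mapId Y).inv ▷ T.map f ≫ (T.mapComp (𝟙 Y) f).inv ≫
        T.map₂ (λ_ f).hom) ▷ z.alg := by rw [← whisker_exchange]; bicategory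
    _ = _ := by rw [h]; bicategory

theorem comp_id_ofIso {y : LaxAlg T Y} {z : LaxAlg T Z} {f : Y ⟶ Z} (φ : ColaxStr y z f) :
    (φ.comp (id z)).ofIso (ρ_ f) = φ := by
  ext
  simp only [ofIso, comp, id]
  have h := comp_map₂_rightUnitor T.toPseudofunctor f
  calc
    _ = 𝟙 _ ⊗≫ φ.cell ⊗≫ (T.map f ◁ (T.mapId Z).inv ≫ (T.mapComp f (𝟙 Z)).inv ≫
        T.map₂ (ρ_ f).hom) ▷ z.alg := by bicategory
    _ = _ := by rw [h]; bicategory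

theorem comp_assoc_ofIso {z : LaxAlg T Z} {y : LaxAlg T Y} {x : LaxAlg T X} {t : LaxAlg T W}
    {g : Z ⟶ Y} {h : Y ⟶ X} {l : X ⟶ W} (φ : ColaxStr z y g) (ψ : ColaxStr y x h)
    (χ : ColaxStr x t l) {k : Z ⟶ X} {p : Y ⟶ W} {n : Z ⟶ W} (e : g ≫ h ≅ k) (e' : k ≫ l ≅ n)
    (d : h ≫ l ≅ p) (d' : g ≫ p ≅ n)
    (w : e.hom ▷ l ≫ e'.hom = (α_ _ _ _).hom ≫ g ◁ d.hom ≫ d'.hom) :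
    (((φ.comp ψ).ofIso e).comp χ).ofIso e' = (φ.comp ((ψ.comp χ).ofIso d)).ofIso d' := by
  ext
  simp only [ofIso, comp]
  have h1 := comp_map₂_assoc T.toPseudofunctor e e' d d' w
  have w' : e'.inv ≫ e.inv ▷ l = d'.inv ≫ g ◁ d.inv ≫ (α_ _ _ _).inv := by
    have key : whiskerRightIso e l ≪≫ e' = α_ _ _ _ ≪≫ whiskerLeftIso g d ≪≫ d' := Iso.ext w
    simpa using congrArg Iso.inv key
  calc
    _ = 𝟙 _ ⊗≫ z.alg ◁ (e'.inv ≫ e.inv ▷ l) ⊗≫ φ.cell ▷ (h ≫ l) ⊗≫ T.map g ◁ ψ.cell ▷ l ⊗≫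
        (((T.mapComp g h).inv ≫ T.map₂ e.hom) ▷ (x.alg ≫ l) ≫ T.map k ◁ χ.cell) ⊗≫
          ((T.mapComp k l).inv ≫ T.map₂ e'.hom) ▷ t.alg := by
      bicategory
    _ = 𝟙 _ ⊗≫ z.alg ◁ d'.inv ⊗≫ ((z.alg ≫ g) ◁ d.inv ≫ φ.cell ▷ (h ≫ l)) ⊗≫
        T.map g ◁ ψ.cell ▷ l ⊗≫ T.map g ◁ T.map h ◁ χ.cell ⊗≫
          ((α_ _ _ _).inv ≫ (T.mapComp g h).inv ▷ T.map l ≫ T.map₂ e.hom ▷ T.map l ≫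
            (T.mapComp k l).inv ≫ T.map₂ e'.hom) ▷ t.alg := by
      rw [← whisker_exchange, w']; bicategory
    _ = _ := by
      rw [h1, whisker_exchange]; bicategory

end ColaxStr

section Categories

variable (T : Pseudomonad B) {Y Z : B}

/-- The objects of the category of lax `T`-structures for a 1-cell `g : Z ⟶ Y`: an object of the
arrow category `2` (the source or the target), together with a lax algebra structure on its image
under the inclusion `2 ⟶ B` of `g`. -/
inductive LaxStructures (g : Z ⟶ Y) : Type (max v w)
  /-- A lax algebra structure on the source of `g`. -/
  | src (z : LaxAlg T Z) : LaxStructures g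
  /-- A lax algebra structure on the target of `g`. -/
  | tgt (y : LaxAlg T Y) : LaxStructures g

/-- The objects of the category of colax `T`-structures for a 1-cell `f : Y ⟶ Z`: an object of
`2` together with a lax algebra structure on its image under the inclusion `2 ⟶ B` of `f`. -/
inductive ColaxStructures (f : Y ⟶ Z) : Type (max v w)
  /-- A lax algebra structure on the source of `f`. -/
  | src (y : LaxAlg T Y) : ColaxStructures f
  /-- A lax algebra structure on the target of `f`. -/
  | tgt (z : LaxAlg T Z) : ColaxStructures f

variable {T}

/-- The arrows of the category of lax `T`-structures for `g`: an arrow of `2` together with a lax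
morphism structure on its image, which is `𝟙 Z`, `g` or `𝟙 Y`. -/
def LaxStructures.Hom {g : Z ⟶ Y} : LaxStructures T g → LaxStructures T g → Type w
  | .src z, .src z' => LaxStr z z' (𝟙 Z)
  | .src z, .tgt y => LaxStr z y g
  | .tgt y, .tgt y' => LaxStr y y' (𝟙 Y)
  | .tgt _, .src _ => PEmpty

/-- The arrows of the category of colax `T`-structures for `f`: an arrow of `2` together with a
colax morphism structure on its image, which is `𝟙 Y`, `f` or `𝟙 Z`. -/
def ColaxStructures.Hom {f : Y ⟶ Z} : ColaxStructures T f → ColaxStructures T f → Type w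
  | .src y, .src y' => ColaxStr y y' (𝟙 Y)
  | .src y, .tgt z => ColaxStr y z f
  | .tgt z, .tgt z' => ColaxStr z z' (𝟙 Z)
  | .tgt _, .src _ => PEmpty

theorem leftUnitor_id_eq (Z : B) : λ_ (𝟙 Z) = ρ_ (𝟙 Z) := Iso.ext unitors_equal

/-- The category of lax `T`-structures for `g : Z ⟶ Y`: the pullback of the inclusion `2 ⟶ B` of
`g` along the forgetful functor from lax `T`-algebras and lax `T`-morphisms to `B`. Composition is
the composition of lax morphisms, transported along the unitors `𝟙 ≫ 𝟙 ≅ 𝟙`, `𝟙 ≫ g ≅ g` and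
`g ≫ 𝟙 ≅ g` (which are identities in a 2-category). The only 2-cells over those of `2` are
identities, so that the pullback is a category. -/
instance (g : Z ⟶ Y) : Category.{w} (LaxStructures T g) where
  Hom := LaxStructures.Hom
  id
    | .src z => LaxStr.id z
    | .tgt y => LaxStr.id y
  comp {a b c} φ ψ := match a, b, c, φ, ψ with
    | .src _, .src _, .src _, φ, ψ => (LaxStr.comp φ ψ).ofIso (λ_ (𝟙 Z))
    | .src _, .src _, .tgt _, φ, ψ => (LaxStr.comp φ ψ).ofIso (λ_ g)
    | .src _, .tgt _, .tgt _, φ, ψ => (LaxStr.comp φ ψ).ofIso (ρ_ g)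
    | .tgt _, .tgt _, .tgt _, φ, ψ => (LaxStr.comp φ ψ).ofIso (λ_ (𝟙 Y))
  id_comp {a b} φ := match a, b, φ with
    | .src _, .src _, φ => LaxStr.id_comp_ofIso φ
    | .src _, .tgt _, φ => LaxStr.id_comp_ofIso φ
    | .tgt _, .tgt _, φ => LaxStr.id_comp_ofIso φ
  comp_id {a b} φ := match a, b, φ with
    | .src _, .src z', φ =>
      (congrArg (LaxStr.ofIso (LaxStr.comp φ (LaxStr.id z'))) (leftUnitor_id_eq Z)).trans
        (LaxStr.comp_id_ofIso φ)
    | .src _, .tgt _, φ => LaxStr.comp_id_ofIso φ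
    | .tgt _, .tgt y', φ =>
      (congrArg (LaxStr.ofIso (LaxStr.comp φ (LaxStr.id y'))) (leftUnitor_id_eq Y)).trans
        (LaxStr.comp_id_ofIso φ)
  assoc {a b c d} φ ψ χ := match a, b, c, d, φ, ψ, χ with
    | .src _, .src _, .src _, .src _, φ, ψ, χ =>
      LaxStr.comp_assoc_ofIso φ ψ χ _ _ _ _ (by bicategory)
    | .src _, .src _, .src _, .tgt _, φ, ψ, χ =>
      LaxStr.comp_assoc_ofIso φ ψ χ _ _ _ _ (by bicategory)
    | .src _, .src _, .tgt _, .tgt _, φ, ψ, χ =>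
      LaxStr.comp_assoc_ofIso φ ψ χ _ _ _ _ (by bicategory)
    | .src _, .tgt _, .tgt _, .tgt _, φ, ψ, χ =>
      LaxStr.comp_assoc_ofIso φ ψ χ _ _ _ _ (by bicategory)
    | .tgt _, .tgt _, .tgt _, .tgt _, φ, ψ, χ =>
      LaxStr.comp_assoc_ofIso φ ψ χ _ _ _ _ (by bicategory)

/-- The category of colax `T`-structures for `f : Y ⟶ Z`: the pullback of the inclusion `2 ⟶ B`
of `f` along the forgetful functor from lax `T`-algebras and colax `T`-morphisms to `B`. -/
instance (f : Y ⟶ Z) : Category.{w} (ColaxStructures T f) where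
  Hom := ColaxStructures.Hom
  id
    | .src y => ColaxStr.id y
    | .tgt z => ColaxStr.id z
  comp {a b c} φ ψ := match a, b, c, φ, ψ with
    | .src _, .src _, .src _, φ, ψ => (ColaxStr.comp φ ψ).ofIso (λ_ (𝟙 Y))
    | .src _, .src _, .tgt _, φ, ψ => (ColaxStr.comp φ ψ).ofIso (λ_ f)
    | .src _, .tgt _, .tgt _, φ, ψ => (ColaxStr.comp φ ψ).ofIso (ρ_ f)
    | .tgt _, .tgt _, .tgt _, φ, ψ => (ColaxStr.comp φ ψ).ofIso (λ_ (𝟙 Z))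
  id_comp {a b} φ := match a, b, φ with
    | .src _, .src _, φ => ColaxStr.id_comp_ofIso φ
    | .src _, .tgt _, φ => ColaxStr.id_comp_ofIso φ
    | .tgt _, .tgt _, φ => ColaxStr.id_comp_ofIso φ
  comp_id {a b} φ := match a, b, φ with
    | .src _, .src y', φ =>
      (congrArg (ColaxStr.ofIso (ColaxStr.comp φ (ColaxStr.id y'))) (leftUnitor_id_eq Y)).trans
        (ColaxStr.comp_id_ofIso φ)
    | .src _, .tgt _, φ => ColaxStr.comp_id_ofIso φ
    | .tgt _, .tgt z', φ =>
      (congrArg (ColaxStr.ofIso (ColaxStr.comp φ (ColaxStr.id z'))) (leftUnitor_id_eq Z)).trans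
        (ColaxStr.comp_id_ofIso φ)
  assoc {a b c d} φ ψ χ := match a, b, c, d, φ, ψ, χ with
    | .src _, .src _, .src _, .src _, φ, ψ, χ =>
      ColaxStr.comp_assoc_ofIso φ ψ χ _ _ _ _ (by bicategory)
    | .src _, .src _, .src _, .tgt _, φ, ψ, χ =>
      ColaxStr.comp_assoc_ofIso φ ψ χ _ _ _ _ (by bicategory)
    | .src _, .src _, .tgt _, .tgt _, φ, ψ, χ =>
      ColaxStr.comp_assoc_ofIso φ ψ χ _ _ _ _ (by bicategory)
    | .src _, .tgt _, .tgt _, .tgt _, φ, ψ, χ =>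
      ColaxStr.comp_assoc_ofIso φ ψ χ _ _ _ _ (by bicategory)
    | .tgt _, .tgt _, .tgt _, .tgt _, φ, ψ, χ =>
      ColaxStr.comp_assoc_ofIso φ ψ χ _ _ _ _ (by bicategory)

end Categories

section Mates

variable {T : Pseudomonad B} {Y Z : B} {f : Y ⟶ Z} {g : Z ⟶ Y}

/-- The 2-cell of the colax structure `ψ` on `f` is the mate of the 2-cell of the lax structure
`φ` on `g`, under the adjunctions `T f ⊣ T g` (induced by the pseudofunctor `T`) and `f ⊣ g`. -/
def AreMates (adj : f ⊣ g) {y : LaxAlg T Y} {z : LaxAlg T Z} (φ : LaxStr z y g)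
    (ψ : ColaxStr y z f) : Prop :=
  ψ.cell = (mateEquiv (T.mapAdjunction adj) adj).symm φ.cell

/-- The correspondence between lax algebras over the source and the target of `g : Z ⟶ Y` and
lax algebras over the target and the source of `f : Y ⟶ Z`. -/
def LaxStructures.reverse (f : Y ⟶ Z) : LaxStructures T g → ColaxStructures T f
  | .src z => .tgt z
  | .tgt y => .src y

/-- The arrow `ψ` of the category of colax structures for `f` is the mate of the arrow `φ` of the
category of lax structures for `g`: under `f ⊣ g` for the arrows over the nonidentity arrow of `2`,
and under an identity adjunction for the arrows over an identity of `2`. -/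
def ArrowsAreMates (adj : f ⊣ g) : {x x' : LaxStructures T g} → (x ⟶ x') →
    (x'.reverse f ⟶ x.reverse f) → Prop
  | .src _, .src _, φ, ψ => AreMates (Bicategory.Adjunction.id Z) φ ψ
  | .src _, .tgt _, φ, ψ => AreMates adj φ ψ
  | .tgt _, .tgt _, φ, ψ => AreMates (Bicategory.Adjunction.id Y) φ ψ

end Mates

end PseudomonadTheory

/-! Taking mates is a bijection between squares with sides left adjoints and squares with sides
right adjoints, and it respects pasting. Each coherence equation of a colax structure on `f`
compares two pasted squares with left adjoint sides. Their mates are the two pasted squares of the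
corresponding lax equation on `g`, so injectivity of the mate bijection makes the two equations
equivalent (`cell_mul_iff_of_mateEquiv`, `cell_unit_iff_of_mateEquiv`). Three facts identify the
mates of the pieces. Mates are natural in the two sides that carry no adjunction, which handles the
2-cells `mul` and `unit` of the algebras. A pseudofunctor preserves mates (`hat_mateEquiv`). For a
pseudonatural transformation, the inverse naturality cell at `f` has as mate the naturality cell at
`g` (`mateEquiv_naturality_inv`), which is why the inverses of `mNat` and `ηNat` appear in the colax
equations. Functoriality rests on compatibility of mates with horizontal pasting. The pseudofunctor
takes identity and composite adjunctions to identity and composite ones only up to its compositors,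
and composition in the two categories is corrected by unitors. Both discrepancies are transports of
adjunctions along isomorphisms (`adjunctionOfIso`), and `mateEquiv_adjunctionOfIso` says how mates
change under such a transport. -/

namespace PseudomonadTheory

/-! ### Transport of adjunctions along isomorphisms, and naturality of mates. -/

section AdjunctionLemmas

variable {C : Type*} [Bicategory C]

/-- Transport of an adjunction along isomorphisms of the left and the right adjoint. -/
@[simps]
def adjunctionOfIso {a b : C} {l l' : a ⟶ b} {r r' : b ⟶ a} (adj : l ⊣ r) (d : l ≅ l')
    (e : r ≅ r') : l' ⊣ r' where
  unit := adj.unit ≫ d.hom ▷ r ≫ l' ◁ e.hom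
  counit := e.inv ▷ l' ≫ r ◁ d.inv ≫ adj.counit
  left_triangle := by
    have h : e.hom ≫ e.inv = 𝟙 _ := e.hom_inv_id
    calc
      _ = 𝟙 _ ⊗≫ adj.unit ▷ l' ⊗≫ d.hom ▷ r ▷ l' ⊗≫ l' ◁ (e.hom ≫ e.inv) ▷ l' ⊗≫
          l' ◁ r ◁ d.inv ⊗≫ l' ◁ adj.counit := by
        dsimp only [leftZigzag]; bicategory
      _ = 𝟙 _ ⊗≫ adj.unit ▷ l' ⊗≫ (d.hom ▷ (r ≫ l') ≫ l' ◁ (r ◁ d.inv ≫ adj.counit)) ⊗≫ 𝟙 _ := by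
        rw [h]; bicategory
      -- With `e` cancelled, `d.hom` moves to the end and `d.inv` to the beginning, leaving the old
      -- zigzag conjugated by `d`.
      _ = 𝟙 _ ⊗≫ (adj.unit ▷ l' ≫ (l ≫ r) ◁ d.inv) ⊗≫ (l ◁ adj.counit ≫ d.hom ▷ 𝟙 b) := by
        rw [← whisker_exchange]; bicategory
      _ = 𝟙 _ ⊗≫ d.inv ⊗≫ leftZigzag adj.unit adj.counit ⊗≫ d.hom ⊗≫ 𝟙 _ := by
        rw [← whisker_exchange]; dsimp only [leftZigzag]; bicategory
      _ = 𝟙 _ ⊗≫ (d.inv ≫ d.hom) ⊗≫ 𝟙 _ := by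
        rw [adj.left_triangle]; bicategory
      _ = _ := by
        rw [d.inv_hom_id]; bicategory
  right_triangle := by
    have h : d.hom ≫ d.inv = 𝟙 _ := d.hom_inv_id
    calc
      _ = 𝟙 _ ⊗≫ r' ◁ adj.unit ⊗≫ r' ◁ d.hom ▷ r ⊗≫ (r' ◁ l' ◁ e.hom ≫ e.inv ▷ (l' ≫ r')) ⊗≫
          r ◁ d.inv ▷ r' ⊗≫ adj.counit ▷ r' := by
        dsimp only [rightZigzag]; bicategory
      _ = 𝟙 _ ⊗≫ (r' ◁ (adj.unit ≫ d.hom ▷ r) ≫ e.inv ▷ (l' ≫ r)) ⊗≫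
          r ◁ (l' ◁ e.hom ≫ d.inv ▷ r') ⊗≫ adj.counit ▷ r' := by
        rw [whisker_exchange]; bicategory
      _ = 𝟙 _ ⊗≫ e.inv ▷ 𝟙 a ⊗≫ r ◁ adj.unit ⊗≫ r ◁ (d.hom ≫ d.inv) ▷ r ⊗≫
          ((r ≫ l) ◁ e.hom ≫ adj.counit ▷ r') := by
        rw [whisker_exchange, whisker_exchange]; bicategory
      _ = 𝟙 _ ⊗≫ e.inv ⊗≫ rightZigzag adj.unit adj.counit ⊗≫ e.hom ⊗≫ 𝟙 _ := by
        rw [h, whisker_exchange]; dsimp only [rightZigzag]; bicategory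
      _ = 𝟙 _ ⊗≫ (e.inv ≫ e.hom) ⊗≫ 𝟙 _ := by
        rw [adj.right_triangle]; bicategory
      _ = _ := by
        rw [e.inv_hom_id]; bicategory

section Squares

variable {a b c d : C} {l₁ l₁' : a ⟶ b} {r₁ r₁' : b ⟶ a} {l₂ l₂' : c ⟶ d} {r₂ r₂' : d ⟶ c}
  (adj₁ : l₁ ⊣ r₁) (adj₂ : l₂ ⊣ r₂)

/-- The cell `θ` is disjoint from the unit and the counit, so interchange slides it out. This and
the next lemma absorb the 2-cells `mul` and `unit` of the two algebras. -/
theorem mateEquiv_whiskerRight_comp {g g' : a ⟶ c} {h : b ⟶ d} (θ : g' ⟶ g)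
    (α : g ≫ l₂ ⟶ l₁ ≫ h) :
    mateEquiv adj₁ adj₂ (θ ▷ l₂ ≫ α) = r₁ ◁ θ ≫ mateEquiv adj₁ adj₂ α := by
  simp only [mateEquiv_apply']
  calc
    _ = 𝟙 _ ⊗≫ r₁ ◁ (g' ◁ adj₂.unit ≫ θ ▷ (l₂ ≫ r₂)) ⊗≫ r₁ ◁ α ▷ r₂ ⊗≫
        adj₁.counit ▷ h ▷ r₂ ⊗≫ 𝟙 _ := by bicategory
    _ = _ := by rw [whisker_exchange]; bicategory

theorem mateEquiv_comp_whiskerLeft {g : a ⟶ c} {h h' : b ⟶ d} (α : g ≫ l₂ ⟶ l₁ ≫ h)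
    (θ : h ⟶ h') :
    mateEquiv adj₁ adj₂ (α ≫ l₁ ◁ θ) = mateEquiv adj₁ adj₂ α ≫ θ ▷ r₂ := by
  simp only [mateEquiv_apply']
  calc
    _ = 𝟙 _ ⊗≫ r₁ ◁ g ◁ adj₂.unit ⊗≫ r₁ ◁ α ▷ r₂ ⊗≫
        ((r₁ ≫ l₁) ◁ θ ≫ adj₁.counit ▷ h') ▷ r₂ ⊗≫ 𝟙 _ := by bicategory
    _ = _ := by rw [whisker_exchange]; bicategory

/-- Controls the mate when an adjunction is known only up to isomorphism of its legs, as happens for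
the image of an identity or composite adjunction under a pseudofunctor. -/
theorem mateEquiv_adjunctionOfIso {g : a ⟶ c} {h : b ⟶ d} (d₁ : l₁ ≅ l₁') (e₁ : r₁ ≅ r₁')
    (d₂ : l₂ ≅ l₂') (e₂ : r₂ ≅ r₂') (α : g ≫ l₂' ⟶ l₁' ≫ h) :
    mateEquiv (adjunctionOfIso adj₁ d₁ e₁) (adjunctionOfIso adj₂ d₂ e₂) α =
      e₁.inv ▷ g ≫ mateEquiv adj₁ adj₂ (g ◁ d₂.hom ≫ α ≫ d₁.inv ▷ h) ≫ h ◁ e₂.hom := by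
  simp only [mateEquiv_apply', adjunctionOfIso_unit, adjunctionOfIso_counit]
  -- Interchange carries `e₁.inv` to the left end and `e₂.hom` to the right end, while `d₁` and `d₂`
  -- stay next to `α`.
  calc
    _ = 𝟙 _ ⊗≫ r₁' ◁ g ◁ adj₂.unit ⊗≫ r₁' ◁ g ◁ d₂.hom ▷ r₂ ⊗≫
        r₁' ◁ ((g ≫ l₂') ◁ e₂.hom ≫ α ▷ r₂') ⊗≫ e₁.inv ▷ l₁' ▷ (h ≫ r₂') ⊗≫
          r₁ ◁ d₁.inv ▷ h ▷ r₂' ⊗≫ adj₁.counit ▷ h ▷ r₂' ⊗≫ 𝟙 _ := by bicategory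
    _ = 𝟙 _ ⊗≫ (r₁' ◁ (g ◁ adj₂.unit ⊗≫ g ◁ d₂.hom ▷ r₂ ⊗≫ α ▷ r₂ ⊗≫ (l₁' ≫ h) ◁ e₂.hom) ≫
        e₁.inv ▷ ((l₁' ≫ h) ≫ r₂')) ⊗≫ r₁ ◁ d₁.inv ▷ h ▷ r₂' ⊗≫ adj₁.counit ▷ h ▷ r₂' ⊗≫ 𝟙 _ := by
      rw [whisker_exchange]; bicategory
    _ = 𝟙 _ ⊗≫ e₁.inv ▷ g ⊗≫ r₁ ◁ (g ◁ adj₂.unit ⊗≫ g ◁ d₂.hom ▷ r₂ ⊗≫ α ▷ r₂) ⊗≫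
        r₁ ◁ (l₁' ◁ (h ◁ e₂.hom) ≫ d₁.inv ▷ (h ≫ r₂')) ⊗≫ adj₁.counit ▷ (h ≫ r₂') ⊗≫ 𝟙 _ := by
      rw [whisker_exchange]; bicategory
    _ = 𝟙 _ ⊗≫ e₁.inv ▷ g ⊗≫ r₁ ◁ (g ◁ adj₂.unit ⊗≫ g ◁ d₂.hom ▷ r₂ ⊗≫ α ▷ r₂) ⊗≫
        r₁ ◁ d₁.inv ▷ (h ≫ r₂) ⊗≫ ((r₁ ≫ l₁) ◁ (h ◁ e₂.hom) ≫ adj₁.counit ▷ (h ≫ r₂')) ⊗≫ 𝟙 _ := by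
      rw [whisker_exchange]; bicategory
    _ = _ := by
      rw [whisker_exchange]; bicategory

end Squares

theorem mateEquiv_id {a b : C} (g : a ⟶ b) :
    mateEquiv (Bicategory.Adjunction.id a) (Bicategory.Adjunction.id b)
      ((ρ_ g).hom ≫ (λ_ g).inv) = (λ_ g).hom ≫ (ρ_ g).inv := by
  simp only [mateEquiv_apply', Bicategory.Adjunction.id]
  bicategory

/-- Right adjoints compose in the opposite order, so a left unitor on `l` is paired with a right
unitor on `r`. These are the unitors that correct composition in the categories of structures. -/
theorem adjunctionOfIso_id_comp {a b : C} {l : a ⟶ b} {r : b ⟶ a} (adj : l ⊣ r) :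
    adjunctionOfIso ((Bicategory.Adjunction.id a).comp adj) (λ_ l) (ρ_ r) = adj := by
  ext <;> dsimp only [adjunctionOfIso, Bicategory.Adjunction.id, Bicategory.Adjunction.comp,
    Bicategory.Adjunction.compUnit, Bicategory.Adjunction.compCounit] <;> bicategory

theorem adjunctionOfIso_comp_id {a b : C} {l : a ⟶ b} {r : b ⟶ a} (adj : l ⊣ r) :
    adjunctionOfIso (adj.comp (Bicategory.Adjunction.id b)) (ρ_ l) (λ_ r) = adj := by
  ext <;> dsimp only [adjunctionOfIso, Bicategory.Adjunction.id, Bicategory.Adjunction.comp,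
    Bicategory.Adjunction.compUnit, Bicategory.Adjunction.compCounit] <;> bicategory

end AdjunctionLemmas

/-! ### Images of adjunctions and of mates under a pseudofunctor. -/

section MapAdjunction

variable {C D : Type*} [Bicategory C] [Bicategory D] (F : C ⥤ᵖ D)

theorem map₂_leftUnitor_inv {a b : C} (g : a ⟶ b) :
    F.map₂ (λ_ g).inv = (λ_ (F.map g)).inv ≫ (F.mapId a).inv ▷ F.map g ≫
      (F.mapComp (𝟙 a) g).inv := by
  simpa using congrArg (· ≫ (F.mapId a).inv ▷ F.map g ≫ (F.mapComp (𝟙 a) g).inv)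
    (map₂_leftUnitor_inv_comp F g)

theorem map₂_rightUnitor_inv {a b : C} (g : a ⟶ b) :
    F.map₂ (ρ_ g).inv = (ρ_ (F.map g)).inv ≫ F.map g ◁ (F.mapId b).inv ≫
      (F.mapComp g (𝟙 b)).inv := by
  simpa using congrArg (· ≫ F.map g ◁ (F.mapId b).inv ≫ (F.mapComp g (𝟙 b)).inv)
    (map₂_rightUnitor_inv_comp F g)

theorem map₂_associator_inv {a b c d : C} (f : a ⟶ b) (g : b ⟶ c) (h : c ⟶ d) :
    F.map₂ (α_ f g h).inv = (F.mapComp f (g ≫ h)).hom ≫ F.map f ◁ (F.mapComp g h).hom ≫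
      (α_ (F.map f) (F.map g) (F.map h)).inv ≫ (F.mapComp f g).inv ▷ F.map h ≫
        (F.mapComp (f ≫ g) h).inv := by
  rw [← cancel_epi (F.map₂ (α_ f g h).hom), ← F.map₂_comp, Iso.hom_inv_id,
    Pseudofunctor.map₂_associator]
  simp

theorem mapAdjunction_id (a : C) :
    F.mapAdjunction (Bicategory.Adjunction.id a) =
      adjunctionOfIso (Bicategory.Adjunction.id (F.obj a)) (F.mapId a).symm (F.mapId a).symm := by
  ext
  · dsimp only [adjunctionOfIso, Bicategory.Adjunction.id, Pseudofunctor.mapAdjunction]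
    rw [map₂_rightUnitor_inv]
    simp
  · dsimp only [adjunctionOfIso, Bicategory.Adjunction.id, Pseudofunctor.mapAdjunction]
    rw [Pseudofunctor.map₂_right_unitor]
    -- In `F.map (𝟙 a) ≫ F.map (𝟙 a)`, contracting the left factor or the right one gives the same
    -- 2-cell, by interchange.
    have h := whisker_exchange (F.mapId a).hom (F.mapId a).hom
    simp only [whiskerRight_id, id_whiskerLeft, unitors_inv_equal, ← Category.assoc,
      cancel_mono] at h
    simp [reassoc_of% h]

theorem mapAdjunction_adjunctionOfIso {a b : C} {l l' : a ⟶ b} {r r' : b ⟶ a} (adj : l ⊣ r)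
    (d : l ≅ l') (e : r ≅ r') :
    F.mapAdjunction (adjunctionOfIso adj d e) =
      adjunctionOfIso (F.mapAdjunction adj) (F.map₂Iso d) (F.map₂Iso e) := by
  ext <;> simp [adjunctionOfIso]

theorem mapAdjunction_comp {a b c : C} {l₁ : a ⟶ b} {r₁ : b ⟶ a} {l₂ : b ⟶ c} {r₂ : c ⟶ b}
    (adj₁ : l₁ ⊣ r₁) (adj₂ : l₂ ⊣ r₂) :
    F.mapAdjunction (adj₁.comp adj₂) =
      adjunctionOfIso ((F.mapAdjunction adj₁).comp (F.mapAdjunction adj₂)) (F.mapComp l₁ l₂).symm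
        (F.mapComp r₂ r₁).symm := by
  -- The compositors for the left and for the right adjoints act on disjoint factors, hence commute.
  have h : (F.mapComp l₁ l₂).inv ▷ F.map r₂ ▷ F.map r₁ ≫ (α_ _ _ _).hom ≫
      F.map (l₁ ≫ l₂) ◁ (F.mapComp r₂ r₁).inv = (α_ _ _ _).hom ≫ (α_ _ _ _).hom ≫
        F.map l₁ ◁ F.map l₂ ◁ (F.mapComp r₂ r₁).inv ≫ (α_ _ _ _).inv ≫
          (F.mapComp l₁ l₂).inv ▷ F.map (r₂ ≫ r₁) := by
    have h := whisker_exchange (F.mapComp l₁ l₂).inv (F.mapComp r₂ r₁).inv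
    rw [← cancel_epi (α_ _ _ _).inv]
    simpa using h.symm
  ext <;> simp [adjunctionOfIso, bicategoricalComp, map₂_associator_inv, map₂_leftUnitor_inv, h]

/-- A mate is a transposition `homEquiv₂` followed by a transposition `homEquiv₁`. This lemma and
the next show that a pseudofunctor preserves each of the two, up to compositors. -/
theorem map₂_homEquiv₁ {b c d : C} {l : b ⟶ c} {r : c ⟶ b} (adj : l ⊣ r) {g : b ⟶ d}
    {h : c ⟶ d} (γ : g ⟶ l ≫ h) :
    (F.mapComp r g).inv ≫ F.map₂ (adj.homEquiv₁ γ) =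
      (F.mapAdjunction adj).homEquiv₁ (F.map₂ γ ≫ (F.mapComp l h).hom) := by
  simp [Bicategory.Adjunction.homEquiv₁_apply, map₂_associator_inv,
    Pseudofunctor.map₂_left_unitor]

theorem map₂_homEquiv₂ {a b c : C} {l : b ⟶ c} {r : c ⟶ b} (adj : l ⊣ r) {g : a ⟶ b}
    {h : a ⟶ c} (α : g ≫ l ⟶ h) :
    F.map₂ (adj.homEquiv₂ α) ≫ (F.mapComp h r).hom =
      (F.mapAdjunction adj).homEquiv₂ ((F.mapComp g l).inv ≫ F.map₂ α) := by
  simp [Bicategory.Adjunction.homEquiv₂_apply, map₂_associator_inv, map₂_rightUnitor_inv]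

theorem homEquiv₁_comp {b c d : C} {l : b ⟶ c} {r : c ⟶ b} (adj : l ⊣ r) {g : b ⟶ d}
    {h h' : c ⟶ d} (γ : g ⟶ l ≫ h) (θ : h ⟶ h') :
    adj.homEquiv₁ (γ ≫ l ◁ θ) = adj.homEquiv₁ γ ≫ θ := by
  have h1 := whisker_exchange adj.counit θ
  simp only [Bicategory.Adjunction.homEquiv₁_apply, whiskerLeft_comp, Category.assoc]
  calc
    _ = r ◁ γ ≫ (α_ _ _ _).inv ≫ ((r ≫ l) ◁ θ ≫ adj.counit ▷ h') ≫ (λ_ _).hom := by simp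
    _ = _ := by rw [h1]; simp

/-- Preservation of mates follows from preservation of both transpositions; the compositors produced
between the two stages cancel. -/
theorem hat_mateEquiv {a b c d : C} {g : a ⟶ c} {h : b ⟶ d} {l₁ : a ⟶ b} {r₁ : b ⟶ a}
    {l₂ : c ⟶ d} {r₂ : d ⟶ c} (adj₁ : l₁ ⊣ r₁) (adj₂ : l₂ ⊣ r₂) (α : g ≫ l₂ ⟶ l₁ ≫ h) :
    hat F (Bicategory.mateEquiv adj₁ adj₂ α) =
      Bicategory.mateEquiv (F.mapAdjunction adj₁) (F.mapAdjunction adj₂) (hat F α) := by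
  have h1 : F.map₂ (adj₂.homEquiv₂ α) = (F.mapAdjunction adj₂).homEquiv₂
      ((F.mapComp g l₂).inv ≫ F.map₂ α) ≫ (F.mapComp (l₁ ≫ h) r₂).inv := by
    rw [← map₂_homEquiv₂]; simp
  have h2 : (F.mapAdjunction adj₂).homEquiv₂ (hat F α) = (F.mapAdjunction adj₂).homEquiv₂
      ((F.mapComp g l₂).inv ≫ F.map₂ α) ≫ (F.mapComp l₁ h).hom ▷ F.map r₂ := by
    simp [hat, Bicategory.Adjunction.homEquiv₂_apply]
  rw [Bicategory.mateEquiv_apply, Bicategory.mateEquiv_apply, hat, ← Category.assoc,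
    map₂_homEquiv₁, ← homEquiv₁_comp, F.map₂_comp, h1, h2]
  simp

end MapAdjunction

/-! ### Mates of pseudonaturality cells. -/

section StrongTransMates

variable {C D : Type*} [Bicategory C] [Bicategory D] {F G : C ⥤ᵖ D}
  (θ : Pseudofunctor.StrongTrans F G) {a b : C} {f : a ⟶ b} {g : b ⟶ a} (adj : f ⊣ g)

/-- The two naturality cells paste to the one at `g ≫ f`; naturality with respect to the 2-cell
`adj.counit` moves it to `𝟙 b`, where it is trivial up to `mapId`. -/
theorem naturality_counit :
    F.map g ◁ (θ.naturality f).hom ⊗≫ (θ.naturality g).hom ▷ G.map f ⊗≫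
        θ.app b ◁ (G.mapAdjunction adj).counit =
      𝟙 _ ⊗≫ (F.mapAdjunction adj).counit ▷ θ.app b ⊗≫ 𝟙 _ := by
  have h1 := θ.naturality_comp g f
  have h2 := θ.naturality_naturality adj.counit
  have h3 := θ.naturality_id b
  have h4 : (F.mapComp g f).inv ≫ (F.mapComp g f).hom = 𝟙 _ := by simp
  have h5 : (G.mapComp g f).hom ≫ (G.mapComp g f).inv = 𝟙 _ := by simp
  simp only [Pseudofunctor.mapAdjunction_counit]
  calc
    -- The inserted compositor completes the right-hand side of `naturality_comp`.
    _ = 𝟙 _ ⊗≫ ((F.mapComp g f).inv ≫ (F.mapComp g f).hom) ▷ θ.app b ⊗≫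
        F.map g ◁ (θ.naturality f).hom ⊗≫ (θ.naturality g).hom ▷ G.map f ⊗≫
          θ.app b ◁ ((G.mapComp g f).inv ≫ G.map₂ adj.counit ≫ (G.mapId b).hom) := by
      rw [h4]; bicategory
    _ = 𝟙 _ ⊗≫ (F.mapComp g f).inv ▷ θ.app b ⊗≫ ((F.mapComp g f).hom ▷ θ.app b ≫
        (α_ _ _ _).hom ≫ F.map g ◁ (θ.naturality f).hom ≫ (α_ _ _ _).inv ≫
          (θ.naturality g).hom ▷ G.map f ≫ (α_ _ _ _).hom) ⊗≫
            θ.app b ◁ ((G.mapComp g f).inv ≫ G.map₂ adj.counit ≫ (G.mapId b).hom) := by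
      bicategory
    _ = 𝟙 _ ⊗≫ (F.mapComp g f).inv ▷ θ.app b ⊗≫ (θ.naturality (g ≫ f)).hom ⊗≫
        θ.app b ◁ ((G.mapComp g f).hom ≫ (G.mapComp g f).inv) ⊗≫
          θ.app b ◁ G.map₂ adj.counit ⊗≫ θ.app b ◁ (G.mapId b).hom := by
      rw [← h1]; bicategory
    _ = 𝟙 _ ⊗≫ (F.mapComp g f).inv ▷ θ.app b ⊗≫ ((θ.naturality (g ≫ f)).hom ≫
          θ.app b ◁ G.map₂ adj.counit) ⊗≫ θ.app b ◁ (G.mapId b).hom := by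
      rw [h5]; bicategory
    _ = 𝟙 _ ⊗≫ (F.mapComp g f).inv ▷ θ.app b ⊗≫ F.map₂ adj.counit ▷ θ.app b ⊗≫
        ((θ.naturality (𝟙 b)).hom ≫ θ.app b ◁ (G.mapId b).hom) := by
      rw [← h2]; bicategory
    _ = _ := by
      rw [h3]; bicategory

/-- The inverse mate of the cell at `g` is an inverse to the cell at `f`: in their composite,
`naturality_counit` replaces the counit of the image under `G` by that under `F`, and a triangle
identity finishes. -/
theorem mateEquiv_naturality_inv :
    Bicategory.mateEquiv (F.mapAdjunction adj) (G.mapAdjunction adj) (θ.naturality f).inv =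
      (θ.naturality g).hom := by
  rw [← Equiv.eq_symm_apply, ← cancel_epi (θ.naturality f).hom, Iso.hom_inv_id,
    Bicategory.mateEquiv_symm_apply']
  symm
  calc
    _ = 𝟙 _ ⊗≫ (𝟙 _ ◁ (θ.naturality f).hom ≫
        (F.mapAdjunction adj).unit ▷ (θ.app a ≫ G.map f)) ⊗≫
          F.map f ◁ (θ.naturality g).hom ▷ G.map f ⊗≫
            F.map f ◁ θ.app b ◁ (G.mapAdjunction adj).counit ⊗≫ 𝟙 _ := by
      bicategory
    _ = 𝟙 _ ⊗≫ (F.mapAdjunction adj).unit ▷ (F.map f ≫ θ.app b) ⊗≫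
          F.map f ◁ (F.map g ◁ (θ.naturality f).hom ⊗≫ (θ.naturality g).hom ▷ G.map f ⊗≫
            θ.app b ◁ (G.mapAdjunction adj).counit) ⊗≫ 𝟙 _ := by
      rw [whisker_exchange]; bicategory
    _ = 𝟙 _ ⊗≫ leftZigzag (F.mapAdjunction adj).unit (F.mapAdjunction adj).counit ▷ θ.app b
          ⊗≫ 𝟙 _ := by
      rw [naturality_counit]; dsimp only [leftZigzag]; bicategory
    _ = _ := by
      rw [Bicategory.Adjunction.left_triangle]; bicategory

end StrongTransMates

/-- Needed because the source of `m` is the composite pseudofunctor, whereas the multiplication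
equations involve the adjunction obtained by applying `T` twice. -/
theorem mapAdjunction_comp_pseudofunctor {C D E : Type*} [Bicategory C] [Bicategory D]
    [Bicategory E] (F : C ⥤ᵖ D) (G : D ⥤ᵖ E) {a b : C} {f : a ⟶ b} {g : b ⟶ a} (adj : f ⊣ g) :
    (F.comp G).mapAdjunction adj = G.mapAdjunction (F.mapAdjunction adj) := by
  ext
  -- The stated middle term unfolds the unit and composition constraints of `F.comp G`, after which
  -- only functoriality of `G.map₂` remains.
  · refine Eq.trans (b := ((G.mapId _).inv ≫ G.map₂ (F.mapId a).inv) ≫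
      G.map₂ (F.map₂ adj.unit) ≫ G.map₂ (F.mapComp f g).hom ≫ (G.mapComp _ _).hom) rfl ?_
    simp
  · refine Eq.trans (b := ((G.mapComp _ _).inv ≫ G.map₂ (F.mapComp g f).inv) ≫
      G.map₂ (F.map₂ adj.counit) ≫ G.map₂ (F.mapId b).hom ≫ (G.mapId _).hom) rfl ?_
    simp

theorem mapAdjunction_id_pseudofunctor {C : Type*} [Bicategory C] {a b : C} {f : a ⟶ b}
    {g : b ⟶ a} (adj : f ⊣ g) : (Pseudofunctor.id C).mapAdjunction adj = adj := by
  ext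
  · exact (Category.id_comp _).trans (Category.comp_id _)
  · exact (Category.id_comp _).trans (Category.comp_id _)

section MonadMates

variable {B : Type u} [Bicategory.{w, v} B] (T : Pseudomonad B) {Y Z : B} {f : Y ⟶ Z} {g : Z ⟶ Y}
  (adj : f ⊣ g)

theorem mateEquiv_mNat_inv :
    Bicategory.mateEquiv (T.mapAdjunction (T.mapAdjunction adj)) (T.mapAdjunction adj)
      (T.mNat f).inv = (T.mNat g).hom := by
  have h := mateEquiv_naturality_inv T.m adj
  rw [mapAdjunction_comp_pseudofunctor] at h
  exact h

theorem mateEquiv_ηNat_inv :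
    Bicategory.mateEquiv adj (T.mapAdjunction adj) (T.ηNat f).inv = (T.ηNat g).hom := by
  have h := mateEquiv_naturality_inv T.η adj
  rw [mapAdjunction_id_pseudofunctor] at h
  exact h

end MonadMates
-- The mate bijection on structures, and its compatibility with identities and composition.
section MateStructures

variable {B : Type u} [Bicategory.{w, v} B] {T : Pseudomonad B} {X Y Z : B}

/-- Each side of the colax equation has as mate, under `T.mapAdjunction (T.mapAdjunction adj)` and
`adj`, the corresponding side of the lax equation; the vertical pastings go through `T.mapAdjunction
adj`. -/
theorem cell_mul_iff_of_mateEquiv {f : Y ⟶ Z} {g : Z ⟶ Y} (adj : f ⊣ g) (y : LaxAlg T Y)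
    (z : LaxAlg T Z) {p : y.alg ≫ f ⟶ T.map f ≫ z.alg} {q : T.map g ≫ y.alg ⟶ z.alg ≫ g}
    (h : Bicategory.mateEquiv (T.mapAdjunction adj) adj p = q) :
    ((α_ _ _ _).inv ≫ hat T.toPseudofunctor q ▷ y.alg ≫ (α_ _ _ _).hom ≫
        T.map z.alg ◁ q ≫ (α_ _ _ _).inv ≫ z.mul ▷ g ≫ (α_ _ _ _).hom =
      T.map (T.map g) ◁ y.mul ≫ (α_ _ _ _).inv ≫ (T.mNat g).hom ▷ y.alg ≫ (α_ _ _ _).hom ≫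
        T.mApp Z ◁ q) ↔
    (T.map y.alg ◁ p ≫ (α_ _ _ _).inv ≫ hat T.toPseudofunctor p ▷ z.alg ≫
        (α_ _ _ _).hom ≫ T.map (T.map f) ◁ z.mul =
      (α_ _ _ _).inv ≫ y.mul ▷ f ≫ (α_ _ _ _).hom ≫ T.mApp Y ◁ p ≫ (α_ _ _ _).inv ≫
        (T.mNat f).inv ▷ z.alg ≫ (α_ _ _ _).hom) := by
  have hl : Bicategory.mateEquiv (T.mapAdjunction (T.mapAdjunction adj)) adj
      (leftAdjointSquare.vcomp (hat T.toPseudofunctor p) p ≫ T.map (T.map f) ◁ z.mul) =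
        rightAdjointSquare.vcomp (hat T.toPseudofunctor q) q ≫ z.mul ▷ g := by
    rw [mateEquiv_comp_whiskerLeft, mateEquiv_vcomp _ (T.mapAdjunction adj), ← hat_mateEquiv, h]
  have hr : Bicategory.mateEquiv (T.mapAdjunction (T.mapAdjunction adj)) adj
      (y.mul ▷ f ≫ leftAdjointSquare.vcomp (T.mNat f).inv p) =
        T.map (T.map g) ◁ y.mul ≫ rightAdjointSquare.vcomp (T.mNat g).hom q := by
    rw [mateEquiv_whiskerRight_comp, mateEquiv_vcomp _ (T.mapAdjunction adj),
      mateEquiv_mNat_inv, h]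
  -- Cancelling one associator on each equation gives both the bracketing of pasted squares.
  rw [← cancel_mono (α_ _ _ _).inv]
  conv_rhs => rw [← cancel_epi (α_ _ _ _).hom]
  refine (Eq.congr (Eq.trans ?_ hl.symm) (Eq.trans ?_ hr.symm)).trans
    ((Equiv.apply_eq_iff_eq _).trans (Eq.congr ?_ ?_))
  · simp [rightAdjointSquare.vcomp]
  · simp [rightAdjointSquare.vcomp]
  · simp [leftAdjointSquare.vcomp]
  · simp [leftAdjointSquare.vcomp]

theorem mateEquiv_unitors {C : Type*} [Bicategory C] {a b : C} {l : a ⟶ b} {r : b ⟶ a}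
    (adj : l ⊣ r) :
    Bicategory.mateEquiv adj adj ((λ_ l).hom ≫ (ρ_ l).inv) = (ρ_ r).hom ≫ (λ_ r).inv := by
  rw [← cancel_epi (ρ_ r).inv, ← cancel_mono (λ_ r).hom]
  simp

/-- Since `η` starts at the identity pseudofunctor, both outer adjunctions are `adj`. The side
without `ηNat` is the identity square on `f` followed by `z.unit`, whence `mateEquiv_unitors`. -/
theorem cell_unit_iff_of_mateEquiv {f : Y ⟶ Z} {g : Z ⟶ Y} (adj : f ⊣ g) (y : LaxAlg T Y)
    (z : LaxAlg T Z) {p : y.alg ≫ f ⟶ T.map f ≫ z.alg} {q : T.map g ≫ y.alg ⟶ z.alg ≫ g}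
    (h : Bicategory.mateEquiv (T.mapAdjunction adj) adj p = q) :
    ((ρ_ g).inv ≫ g ◁ y.unit ≫ (α_ _ _ _).inv ≫ (T.ηNat g).hom ▷ y.alg ≫ (α_ _ _ _).hom ≫
        T.ηApp Z ◁ q =
      (λ_ g).inv ≫ z.unit ▷ g ≫ (α_ _ _ _).hom) ↔
    ((λ_ f).inv ≫ y.unit ▷ f ≫ (α_ _ _ _).hom ≫ T.ηApp Y ◁ p ≫ (α_ _ _ _).inv ≫
        (T.ηNat f).inv ▷ z.alg ≫ (α_ _ _ _).hom =
      (ρ_ f).inv ≫ f ◁ z.unit) := by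
  have hl : Bicategory.mateEquiv adj adj
      (y.unit ▷ f ≫ leftAdjointSquare.vcomp (T.ηNat f).inv p) =
        g ◁ y.unit ≫ rightAdjointSquare.vcomp (T.ηNat g).hom q := by
    rw [mateEquiv_whiskerRight_comp, mateEquiv_vcomp _ (T.mapAdjunction adj),
      mateEquiv_ηNat_inv, h]
  have hr : Bicategory.mateEquiv adj adj (((λ_ f).hom ≫ (ρ_ f).inv) ≫ f ◁ z.unit) =
        ((ρ_ g).hom ≫ (λ_ g).inv) ≫ z.unit ▷ g := by
    rw [mateEquiv_comp_whiskerLeft, mateEquiv_unitors]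
  rw [← cancel_mono (α_ _ _ _).inv, ← cancel_epi (ρ_ g).hom]
  conv_rhs => rw [← cancel_epi (λ_ f).hom]
  refine (Eq.congr (Eq.trans ?_ hl.symm) (Eq.trans ?_ hr.symm)).trans
    ((Equiv.apply_eq_iff_eq _).trans (Eq.congr ?_ ?_))
  · simp [rightAdjointSquare.vcomp]
  · simp
  · simp [leftAdjointSquare.vcomp]
  · simp

/-- The bijection between lax structures on the right adjoint and colax structures on the left
adjoint given by taking mates. -/
@[simps]
def laxStrEquivColaxStr {f : Y ⟶ Z} {g : Z ⟶ Y} (adj : f ⊣ g) (y : LaxAlg T Y)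
    (z : LaxAlg T Z) : LaxStr z y g ≃ ColaxStr y z f where
  toFun φ :=
    { cell := (Bicategory.mateEquiv (T.mapAdjunction adj) adj).symm φ.cell
      cell_mul := (cell_mul_iff_of_mateEquiv adj y z (Equiv.apply_symm_apply _ _)).1 φ.cell_mul
      cell_unit :=
        (cell_unit_iff_of_mateEquiv adj y z (Equiv.apply_symm_apply _ _)).1 φ.cell_unit }
  invFun ψ :=
    { cell := Bicategory.mateEquiv (T.mapAdjunction adj) adj ψ.cell
      cell_mul := (cell_mul_iff_of_mateEquiv adj y z rfl).2 ψ.cell_mul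
      cell_unit := (cell_unit_iff_of_mateEquiv adj y z rfl).2 ψ.cell_unit }
  left_inv _ := LaxStr.ext (Equiv.apply_symm_apply _ _)
  right_inv _ := ColaxStr.ext (Equiv.symm_apply_apply _ _)

/-- The rules are proved for the inverse bijection because `mateEquiv` goes from left adjoint
squares to right adjoint squares, that is, from colax to lax. -/
theorem laxStrEquivColaxStr_symm_id (z : LaxAlg T Z) :
    (laxStrEquivColaxStr (Bicategory.Adjunction.id Z) z z).symm (ColaxStr.id z) =
      LaxStr.id z := by
  ext
  -- Only the image adjunction needs transport, along `mapId`; the other one is transported along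
  -- `Iso.refl` to fit the lemma.
  have h := mateEquiv_adjunctionOfIso (Bicategory.Adjunction.id (T.obj Z))
    (Bicategory.Adjunction.id Z) (T.mapId Z).symm (T.mapId Z).symm (Iso.refl _) (Iso.refl _)
    (ColaxStr.id z).cell
  have h' : adjunctionOfIso (Bicategory.Adjunction.id Z) (Iso.refl _) (Iso.refl _) =
      Bicategory.Adjunction.id Z := by ext <;> simp
  rw [h', ← mapAdjunction_id] at h
  rw [laxStrEquivColaxStr_symm_apply_cell, h]
  simp [ColaxStr.id, LaxStr.id, mateEquiv_id]

theorem laxStrEquivColaxStr_symm_ofIso {f f' : Y ⟶ Z} {g g' : Z ⟶ Y} (adj : f ⊣ g)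
    {y : LaxAlg T Y} {z : LaxAlg T Z} (ψ : ColaxStr y z f) (d : f ≅ f') (e : g ≅ g') :
    (laxStrEquivColaxStr (adjunctionOfIso adj d e) y z).symm (ψ.ofIso d) =
      ((laxStrEquivColaxStr adj y z).symm ψ).ofIso e := by
  ext
  -- The transport of the adjunctions conjugates by `d`, undoing the conjugation in
  -- `ColaxStr.ofIso`; what remains is conjugation by `e`.
  have h : T.map₂ d.hom ≫ T.map₂ d.inv = 𝟙 _ := by simp [← T.map₂_comp]
  rw [laxStrEquivColaxStr_symm_apply_cell, mapAdjunction_adjunctionOfIso,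
    mateEquiv_adjunctionOfIso]
  simp [ColaxStr.ofIso, LaxStr.ofIso, ← comp_whiskerRight, h]

theorem laxStrEquivColaxStr_symm_comp {f : Y ⟶ Z} {g : Z ⟶ Y} (adj : f ⊣ g) {k : X ⟶ Y}
    {h : Y ⟶ X} (adj' : k ⊣ h) {x : LaxAlg T X} {y : LaxAlg T Y} {z : LaxAlg T Z}
    (ψ : ColaxStr y z f) (ψ' : ColaxStr x y k) :
    (laxStrEquivColaxStr (adj'.comp adj) x z).symm (ψ'.comp ψ) =
      ((laxStrEquivColaxStr adj y z).symm ψ).comp ((laxStrEquivColaxStr adj' x y).symm ψ') := by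
  ext
  have h1 := mateEquiv_adjunctionOfIso ((T.mapAdjunction adj').comp (T.mapAdjunction adj))
    (adj'.comp adj) (T.mapComp k f).symm (T.mapComp g h).symm (Iso.refl _) (Iso.refl _)
    (ψ'.comp ψ).cell
  have h2 : adjunctionOfIso (adj'.comp adj) (Iso.refl _) (Iso.refl _) = adj'.comp adj := by
    ext <;> simp [-Bicategory.Adjunction.comp_unit, -Bicategory.Adjunction.comp_counit]
  -- The compositor in the composite colax cell is the one by which `mapAdjunction_comp` transports,
  -- so removing it leaves a bare horizontal pasting.
  have h3 : x.alg ◁ (Iso.refl (k ≫ f)).hom ≫ (ψ'.comp ψ).cell ≫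
      (T.mapComp k f).symm.inv ▷ z.alg = leftAdjointSquare.hcomp ψ'.cell ψ.cell := by
    simp [ColaxStr.comp, leftAdjointSquare.hcomp]
  rw [h2, ← mapAdjunction_comp, h3, Bicategory.mateEquiv_hcomp] at h1
  rw [laxStrEquivColaxStr_symm_apply_cell, h1]
  simp [rightAdjointSquare.hcomp, LaxStr.comp]

theorem laxStrEquivColaxStr_symm_comp_ofIso {f : Y ⟶ Z} {g : Z ⟶ Y} (adj : f ⊣ g) {k : X ⟶ Y}
    {h : Y ⟶ X} (adj' : k ⊣ h) {l : X ⟶ Z} {r : Z ⟶ X} (adj'' : l ⊣ r) (d : k ≫ f ≅ l)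
    (e : g ≫ h ≅ r) (hd : adjunctionOfIso (adj'.comp adj) d e = adj'') {x : LaxAlg T X}
    {y : LaxAlg T Y} {z : LaxAlg T Z} (ψ : ColaxStr y z f) (ψ' : ColaxStr x y k) :
    (laxStrEquivColaxStr adj'' x z).symm ((ψ'.comp ψ).ofIso d) =
      (((laxStrEquivColaxStr adj y z).symm ψ).comp
        ((laxStrEquivColaxStr adj' x y).symm ψ')).ofIso e := by
  rw [← hd, laxStrEquivColaxStr_symm_ofIso, laxStrEquivColaxStr_symm_comp]

theorem laxStrEquivColaxStr_comp_ofIso {f : Y ⟶ Z} {g : Z ⟶ Y} (adj : f ⊣ g) {k : X ⟶ Y}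
    {h : Y ⟶ X} (adj' : k ⊣ h) {l : X ⟶ Z} {r : Z ⟶ X} (adj'' : l ⊣ r) (d : k ≫ f ≅ l)
    (e : g ≫ h ≅ r) (hd : adjunctionOfIso (adj'.comp adj) d e = adj'') {x : LaxAlg T X}
    {y : LaxAlg T Y} {z : LaxAlg T Z} (φ : LaxStr z y g) (φ' : LaxStr y x h) :
    laxStrEquivColaxStr adj'' x z ((φ.comp φ').ofIso e) =
      ((laxStrEquivColaxStr adj' x y φ').comp (laxStrEquivColaxStr adj y z φ)).ofIso d := by
  rw [← Equiv.eq_symm_apply, laxStrEquivColaxStr_symm_comp_ofIso adj adj' adj'' d e hd,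
    Equiv.symm_apply_apply, Equiv.symm_apply_apply]

theorem laxStrEquivColaxStr_id (z : LaxAlg T Z) :
    laxStrEquivColaxStr (Bicategory.Adjunction.id Z) z z (LaxStr.id z) = ColaxStr.id z := by
  rw [← laxStrEquivColaxStr_symm_id, Equiv.apply_symm_apply]

/-- Composition over an identity of `2` uses the left unitor in both categories. This fits the
left-right pairing of `adjunctionOfIso_id_comp` because the two unitors of `𝟙 Z` coincide. -/
theorem adjunctionOfIso_id_comp_id (Z : B) :
    adjunctionOfIso ((Bicategory.Adjunction.id Z).comp (Bicategory.Adjunction.id Z)) (λ_ (𝟙 Z))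
      (λ_ (𝟙 Z)) = Bicategory.Adjunction.id Z := by
  conv_lhs => rw [leftUnitor_id_eq Z]
  conv_lhs => arg 2; rw [← leftUnitor_id_eq Z]
  exact adjunctionOfIso_id_comp _

end MateStructures

/-! ### The isomorphism of categories. -/

section MateFunctors

variable {B : Type u} [Bicategory.{w, v} B] {T : Pseudomonad B} {Y Z : B} {f : Y ⟶ Z} {g : Z ⟶ Y}
  (adj : f ⊣ g)

/-- The functor from lax structures for `g` to colax structures for its left adjoint `f` that sends
each arrow to its mate. -/
def mateFunctor : LaxStructures T g ⥤ (ColaxStructures T f)ᵒᵖ where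
  obj x := Opposite.op (x.reverse f)
  map {x x'} φ := Quiver.Hom.op (X := x'.reverse f) (Y := x.reverse f) <| match x, x', φ with
    | .src z, .src z', φ => laxStrEquivColaxStr (Bicategory.Adjunction.id Z) z' z φ
    | .src z, .tgt y, φ => laxStrEquivColaxStr adj y z φ
    | .tgt y, .tgt y', φ => laxStrEquivColaxStr (Bicategory.Adjunction.id Y) y' y φ
  map_id
    | .src z => congrArg Quiver.Hom.op (laxStrEquivColaxStr_id z)
    | .tgt y => congrArg Quiver.Hom.op (laxStrEquivColaxStr_id y)
  map_comp {x x' x''} φ ψ := match x, x', x'', φ, ψ with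
    | .src _, .src _, .src _, φ, ψ => congrArg Quiver.Hom.op
      (laxStrEquivColaxStr_comp_ofIso _ _ _ _ _ (adjunctionOfIso_id_comp_id Z) φ ψ)
    -- Passing to mates reverses composition: an identity preceding `g` becomes an identity
    -- following `f`, so `λ_ g` is matched with `ρ_ f`.
    | .src _, .src _, .tgt _, φ, ψ => congrArg Quiver.Hom.op
      (laxStrEquivColaxStr_comp_ofIso _ _ _ _ _ (adjunctionOfIso_comp_id adj) φ ψ)
    | .src _, .tgt _, .tgt _, φ, ψ => congrArg Quiver.Hom.op
      (laxStrEquivColaxStr_comp_ofIso _ _ _ _ _ (adjunctionOfIso_id_comp adj) φ ψ)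
    | .tgt _, .tgt _, .tgt _, φ, ψ => congrArg Quiver.Hom.op
      (laxStrEquivColaxStr_comp_ofIso _ _ _ _ _ (adjunctionOfIso_id_comp_id Y) φ ψ)

/-- The correspondence between lax algebras over the source and the target of `f : Y ⟶ Z` and
lax algebras over the target and the source of `g : Z ⟶ Y`. -/
def ColaxStructures.reverse (g : Z ⟶ Y) : ColaxStructures T f → LaxStructures T g
  | .src y => .tgt y
  | .tgt z => .src z

/-- The inverse of `mateFunctor`. -/
def mateFunctorInv : (ColaxStructures T f)ᵒᵖ ⥤ LaxStructures T g where
  obj x := x.unop.reverse g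
  map {x x'} ψ := match x, x', ψ with
    | .op (.src y), .op (.src y'), ψ =>
      (laxStrEquivColaxStr (Bicategory.Adjunction.id Y) y' y).symm ψ.unop
    | .op (.tgt z), .op (.src y), ψ => (laxStrEquivColaxStr adj y z).symm ψ.unop
    | .op (.tgt z), .op (.tgt z'), ψ =>
      (laxStrEquivColaxStr (Bicategory.Adjunction.id Z) z' z).symm ψ.unop
  map_id
    | .op (.src y) => laxStrEquivColaxStr_symm_id y
    | .op (.tgt z) => laxStrEquivColaxStr_symm_id z
  map_comp {x x' x''} φ ψ := match x, x', x'', φ, ψ with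
    | .op (.src _), .op (.src _), .op (.src _), φ, ψ =>
      laxStrEquivColaxStr_symm_comp_ofIso _ _ _ _ _ (adjunctionOfIso_id_comp_id Y) φ.unop ψ.unop
    | .op (.tgt _), .op (.src _), .op (.src _), φ, ψ =>
      laxStrEquivColaxStr_symm_comp_ofIso _ _ _ _ _ (adjunctionOfIso_id_comp adj) φ.unop ψ.unop
    | .op (.tgt _), .op (.tgt _), .op (.src _), φ, ψ =>
      laxStrEquivColaxStr_symm_comp_ofIso _ _ _ _ _ (adjunctionOfIso_comp_id adj) φ.unop ψ.unop
    | .op (.tgt _), .op (.tgt _), .op (.tgt _), φ, ψ =>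
      laxStrEquivColaxStr_symm_comp_ofIso _ _ _ _ _ (adjunctionOfIso_id_comp_id Z) φ.unop ψ.unop

/-- After a case split on the objects, the two object maps agree definitionally, so the
heterogeneous equality of arrows is an honest one, given by the bijection of structures. -/
theorem mateFunctor_comp_inv :
    mateFunctor adj ⋙ mateFunctorInv adj = 𝟭 (LaxStructures T g) := by
  refine Functor.hext (fun | .src _ => rfl | .tgt _ => rfl) ?_
  rintro (z | y) (z' | y') φ
  · exact heq_of_eq (Equiv.symm_apply_apply _ _)
  · exact heq_of_eq (Equiv.symm_apply_apply _ _)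
  · exact φ.elim
  · exact heq_of_eq (Equiv.symm_apply_apply _ _)

theorem mateFunctorInv_comp :
    mateFunctorInv adj ⋙ mateFunctor adj = 𝟭 (ColaxStructures T f)ᵒᵖ := by
  refine Functor.hext (fun | .op (.src _) => rfl | .op (.tgt _) => rfl) ?_
  rintro ⟨y | z⟩ ⟨y' | z'⟩ φ
  · exact heq_of_eq (congrArg Quiver.Hom.op (Equiv.apply_symm_apply _ _))
  · exact φ.unop.elim
  · exact heq_of_eq (congrArg Quiver.Hom.op (Equiv.apply_symm_apply _ _))
  · exact heq_of_eq (congrArg Quiver.Hom.op (Equiv.apply_symm_apply _ _))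

end MateFunctors

end PseudomonadTheory

open PseudomonadTheory in
theorem mainTheorem7 {B : Type u} [Bicategory.{w, v} B] (T : Pseudomonad B) {Y Z : B}
    {f : Y ⟶ Z} {g : Z ⟶ Y} (adj : f ⊣ g) :
    (∀ (y : LaxAlg T Y) (z : LaxAlg T Z),
      ∃ e : LaxStr z y g ≃ ColaxStr y z f, ∀ φ : LaxStr z y g, AreMates adj φ (e φ)) ∧
    ∃ (Φ : LaxStructures T g ⥤ (ColaxStructures T f)ᵒᵖ)
      (Ψ : (ColaxStructures T f)ᵒᵖ ⥤ LaxStructures T g),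
      Φ ⋙ Ψ = 𝟭 (LaxStructures T g) ∧ Ψ ⋙ Φ = 𝟭 (ColaxStructures T f)ᵒᵖ ∧
      ∃ hΦ : ∀ x : LaxStructures T g, (Φ.obj x).unop = x.reverse f,
        ∀ (x x' : LaxStructures T g) (φ : x ⟶ x'),
          ArrowsAreMates adj φ (eqToHom (hΦ x').symm ≫ (Φ.map φ).unop ≫ eqToHom (hΦ x)) := by
  refine ⟨fun y z => ⟨laxStrEquivColaxStr adj y z, fun φ => rfl⟩, mateFunctor adj,
    mateFunctorInv adj, mateFunctor_comp_inv adj, mateFunctorInv_comp adj, fun x => rfl, ?_⟩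
  intro x x' φ
  -- The object equality holds by `rfl`, so both `eqToHom` factors are definitionally identities and
  -- only need to be absorbed.
  have key : ∀ ψ : x'.reverse f ⟶ x.reverse f, ArrowsAreMates adj φ ψ →
      ArrowsAreMates adj φ (𝟙 _ ≫ ψ ≫ 𝟙 _) := fun ψ h => by
    rwa [Category.id_comp, Category.comp_id]
  refine key ((mateFunctor adj).map φ).unop ?_
  match x, x', φ with
  | .src _, .src _, _ => rfl
  | .src _, .tgt _, _ => rfl
  | .tgt _, .tgt _, _ => rfl
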